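/- Consider a real state-space plant $P$ with state $x\in\mathbb R^{n_x}$, inputs $(p,w,u)$ and outputs $(q,z,y)$, and a fixed real state-space controller $K$ from $y$ to $u$ such that the feedback loop of $P$ and $K$ is well-posed, i.e. $I-D D_K$ is invertible, where $D$ is the feedthrough $u\to y$ of $P$ and $D_K$ that of $K$. Let $M=\mathcal F_l(P,K)$ be the resulting closed-loop system with inputs $(p,w)$ and outputs $(q,z)$. For $\delta\in\mathbb R^m$ let $\Delta=\Delta(\delta)=\mathrm{diag}[\delta_1I_{r_1},\dots,\delta_mI_{r_m}]$, $\Delta_i=\partial\Delta/\partial\delta_i$, and let $$\begin{bmatrix}\ast & T_{qw}(\delta)\\ T_{zp}(\delta)&T_{zw}(\delta)\end{bmatrix}=\begin{bmatrix}0&I\\ I&\Delta\end{bmatrix}\star M$$ ($\star$ the Redheffer star product), which amounts to closing the loop $p=\Delta q$. Let $\mathbb D$ be the set of those $\delta\in\mathbb R^m$ for which $T_{zw}(\delta)$ is internally stable, i.e. the loop $p=\Delta q$ is well-posed ($I-\Delta\mathcal D$ is invertible, $\mathcal D$ being the feedthrough $p\to q$ of $M$) and the closed-loop state matrix $A(\delta)$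 has all its eigenvalues in the open left half plane. Put $h_-(\delta)=-\|T_{zw}(\delta)\|_\infty$ with $\|T_{zw}(\delta)\|_\infty=\sup_{\omega\in[0,\infty]}\overline\sigma\big(T_{zw}(\delta,j\omega)\big)$, $\overline\sigma$ being the maximum singular value. Then $\mathbb D$ is open, and at every $\delta\in\mathbb D$ the supremum is finite, $h_-$ is Lipschitz on a neighbourhood of $\delta$, and its Clarke subdifferential $\partial h_-(\delta)$ is a non-empty compact convex set. Moreover, suppose that $T_{zw}(\delta)\neq 0$ (equivalently $h_-(\delta)\ne0$). Let $\Omega(\delta)$ be the set of active frequencies, i.e. of those $\omega\in[0,\infty]$ with $\overline\sigma(T_{zw}(\delta,j\omega))=\|T_{zw}(\delta)\|_\infty$. For $\omega\in\Omega(\delta)$ let the columns of $P_\omega$ be an orthonormal basis of the space of right singular vectors of $T_{zw}(\delta,j\omega)$ for its maximum singular value, and let the columns of $Q_\omega$ be the corresponding left singular vectors, so that $T_{zw}(\delta,j\omega)P_\omega=\overline\sigma\,Q_\omega$. Then, for any such choice of $P_\omega$, $Q_\omega$, $$\partial h_-(\delta)=\Big\{\phi_Y:\ Y=(Y_\omega)_{\omega\in\Omega(\delta)},\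 Y_\omega\succeq0 \text{ Hermitian},\ \textstyle\sum_{\omega\in\Omega(\delta)}\mathrm{Trace}(Y_\omega)=1\Big\},$$ where only finitely many $Y_\omega$ are non-zero, and where the $i$-th entry of $\phi_Y\in\mathbb R^m$ is $\mathrm{Trace}(\Delta_i^T\Phi_Y)$ with $$\Phi_Y=-\sum_{\omega\in\Omega(\delta)}\mathrm{Re}\big(T_{qw}(\delta,j\omega)\,P_\omega Y_\omega Q_\omega^H\,T_{zp}(\delta,j\omega)\big)^T .$$ -/

import Mathlib

open scoped Matrix ENNReal ComplexOrder

noncomputable section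

namespace Robust

/-- A real finite-dimensional linear time-invariant system in state space form,
`x' = A x + B v`, `e = C x + D v`, with state index set `n`, input index set `i` and output
index set `o`. -/
structure StateSpace (n i o : Type*) where
  /-- state matrix -/
  A : Matrix n n ℝ
  /-- input matrix -/
  B : Matrix n i ℝ
  /-- output matrix -/
  C : Matrix o n ℝ
  /-- feedthrough matrix -/
  D : Matrix o i ℝ

/-- A real matrix regarded as a complex one. -/
abbrev toC {o i : Type*} (M : Matrix o i ℝ) : Matrix o i ℂ := M.map (fun x : ℝ => (x : ℂ))

namespace StateSpace

variable {n k i i₁ i₂ o o₁ o₂ u y : Type*}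

section Transfer

variable [Fintype n] [DecidableEq n]

/-- The value `C (s I - A)⁻¹ B + D` of the transfer function at `s`. -/
def transfer (G : StateSpace n i o) (s : ℂ) : Matrix o i ℂ :=
  toC G.C * (s • (1 : Matrix n n ℂ) - toC G.A)⁻¹ * toC G.B + toC G.D

/-- The frequency response `G(jω)`, `ω ∈ [0, ∞]`, with `G(j∞) = D`. -/
def freqResponse (G : StateSpace n i o) (ω : ℝ≥0∞) : Matrix o i ℂ :=
  if ω = ⊤ then toC G.D else G.transfer ((ω.toReal : ℂ) * Complex.I)

/-- All eigenvalues of the state matrix have negative real part. -/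
def IsHurwitz (G : StateSpace n i o) : Prop :=
  ∀ z ∈ spectrum ℂ (toC G.A), z.re < 0

end Transfer

section LFT

variable [Fintype u] [DecidableEq u] [Fintype y] [DecidableEq y]

/-- Well-posedness of the loop between the lower channel `u → y` of `G` and `K : y → u`. -/
def LowerWellPosed (G : StateSpace n (i ⊕ u) (o ⊕ y)) (K : StateSpace k y u) : Prop :=
  IsUnit (1 - G.D.toBlocks₂₂ * K.D).det

/-- The lower linear fractional transformation `F_l(G, K)`: the system with state `(x, x_K)`
obtained from `G` by closing its lower channel with the dynamic feedback `K`. -/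
def lowerLFT (G : StateSpace n (i ⊕ u) (o ⊕ y)) (K : StateSpace k y u) :
    StateSpace (n ⊕ k) i o :=
  let B₁ := G.B.toCols₁
  let B₂ := G.B.toCols₂
  let C₁ := G.C.toRows₁
  let C₂ := G.C.toRows₂
  let D₁₁ := G.D.toBlocks₁₁
  let D₁₂ := G.D.toBlocks₁₂
  let D₂₁ := G.D.toBlocks₂₁
  let D₂₂ := G.D.toBlocks₂₂
  let R : Matrix y y ℝ := (1 - D₂₂ * K.D)⁻¹
  let S : Matrix u u ℝ := (1 - K.D * D₂₂)⁻¹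
  { A := Matrix.fromBlocks
      (G.A + B₂ * K.D * R * C₂)  (B₂ * S * K.C)
      (K.B * R * C₂)             (K.A + K.B * R * D₂₂ * K.C)
    B := Matrix.fromRows (B₁ + B₂ * K.D * R * D₂₁) (K.B * R * D₂₁)
    C := Matrix.fromCols (C₁ + D₁₂ * K.D * R * C₂) (D₁₂ * S * K.C)
    D := D₁₁ + D₁₂ * K.D * R * D₂₁ }

/-- Well-posedness of the loop between the lower channel of the constant block matrix `N` and
the upper channel of the system `G`. -/
def StarWellPosed (N : Matrix (o₁ ⊕ y) (i₁ ⊕ u) ℝ) (G : StateSpace n (y ⊕ i₂) (u ⊕ o₂)) : Prop :=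
  IsUnit (1 - N.toBlocks₂₂ * G.D.toBlocks₁₁).det

/-- The Redheffer star product `N ⋆ G` of a constant `2 × 2` block matrix `N` and a system `G`
with two input and two output channels: the second output of `N` is fed to the first input of
`G`, and the first output of `G` is fed to the second input of `N`. -/
def star (N : Matrix (o₁ ⊕ y) (i₁ ⊕ u) ℝ) (G : StateSpace n (y ⊕ i₂) (u ⊕ o₂)) :
    StateSpace n (i₁ ⊕ i₂) (o₁ ⊕ o₂) :=
  let N₁₁ := N.toBlocks₁₁
  let N₁₂ := N.toBlocks₁₂
  let N₂₁ := N.toBlocks₂₁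
  let N₂₂ := N.toBlocks₂₂
  let B₁ := G.B.toCols₁
  let B₂ := G.B.toCols₂
  let C₁ := G.C.toRows₁
  let C₂ := G.C.toRows₂
  let D₁₁ := G.D.toBlocks₁₁
  let D₁₂ := G.D.toBlocks₁₂
  let D₂₁ := G.D.toBlocks₂₁
  let D₂₂ := G.D.toBlocks₂₂
  let R : Matrix y y ℝ := (1 - N₂₂ * D₁₁)⁻¹
  let S : Matrix u u ℝ := (1 - D₁₁ * N₂₂)⁻¹
  { A := G.A + B₁ * R * N₂₂ * C₁
    B := Matrix.fromCols (B₁ * R * N₂₁) (B₂ + B₁ * R * N₂₂ * D₁₂)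
    C := Matrix.fromRows (N₁₂ * S * C₁) (C₂ + D₂₁ * R * N₂₂ * C₁)
    D := Matrix.fromBlocks
      (N₁₁ + N₁₂ * S * D₁₁ * N₂₁)  (N₁₂ * S * D₁₂)
      (D₂₁ * R * N₂₁)              (D₂₂ + D₂₁ * R * N₂₂ * D₁₂) }

end LFT

end StateSpace

/-- Index set of the uncertainty channel: `m` blocks, the `i`-th one of size `r i`. -/
abbrev Chan {m : ℕ} (r : Fin m → ℕ) : Type := (i : Fin m) × Fin (r i)

/-- The uncertain matrix `Δ = diag [δ₁ I_{r₁}, …, δ_m I_{r_m}]`. -/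
def uncertainty {m : ℕ} (r : Fin m → ℕ) (δ : EuclideanSpace ℝ (Fin m)) :
    Matrix (Chan r) (Chan r) ℝ :=
  Matrix.diagonal fun a => δ a.1

/-- The partial derivative `Δ_i = ∂Δ/∂δ_i`, i.e. the identity on the `i`-th block. -/
def uncertaintyPartial {m : ℕ} (r : Fin m → ℕ) (i : Fin m) : Matrix (Chan r) (Chan r) ℝ :=
  Matrix.diagonal fun a => if a.1 = i then 1 else 0

theorem hasDerivAt_uncertainty {m : ℕ} (r : Fin m → ℕ) (i : Fin m)
    (δ : EuclideanSpace ℝ (Fin m)) (a b : Chan r) :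
    HasDerivAt (fun t : ℝ => uncertainty r (δ + t • EuclideanSpace.single i 1) a b)
      (uncertaintyPartial r i a b) 0 := by
  by_cases hab : a = b
  · subst hab
    by_cases ha : a.1 = i
    · simpa [uncertainty, uncertaintyPartial, ha] using (hasDerivAt_id (0 : ℝ)).const_add (δ i)
    · simpa [uncertainty, uncertaintyPartial, ha, PiLp.single_apply] using
        hasDerivAt_const (0 : ℝ) (δ a.1)
  · simpa [uncertainty, uncertaintyPartial, hab] using hasDerivAt_const (0 : ℝ) (0 : ℝ)

/-- The maximum singular value of a complex matrix, i.e. its norm as an operator between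
Euclidean spaces. -/
def sigmaMax {o i : Type*} [Fintype o] [Fintype i] [DecidableEq i] (T : Matrix o i ℂ) : ℝ :=
  ‖LinearMap.toContinuousLinearMap (Matrix.toEuclideanLin T)‖

/-- The `H_∞` norm `sup_{ω ∈ [0, ∞]} σ_max (T(jω))` of a frequency response. -/
def hinfNorm {o i : Type*} [Fintype o] [Fintype i] [DecidableEq i]
    (T : ℝ≥0∞ → Matrix o i ℂ) : ℝ :=
  ⨆ ω : ℝ≥0∞, sigmaMax (T ω)

/-- The set of active frequencies, where the maximum singular value attains the `H_∞` norm. -/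
def activeFreq {o i : Type*} [Fintype o] [Fintype i] [DecidableEq i]
    (T : ℝ≥0∞ → Matrix o i ℂ) : Set ℝ≥0∞ :=
  {ω | sigmaMax (T ω) = hinfNorm T}

/-- The columns of `P` are an orthonormal basis of the space of right singular vectors of `T`
for the maximum singular value, and the columns of `Q` are the corresponding left singular
vectors. -/
structure IsMaxSingularPair {o i k : Type*} [Fintype o] [Fintype i] [DecidableEq i]
    [Fintype k] [DecidableEq k] (T : Matrix o i ℂ) (P : Matrix i k ℂ) (Q : Matrix o k ℂ) :
    Prop where
  right_orthonormal : Pᴴ * P = 1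
  left_orthonormal : Qᴴ * Q = 1
  map_right : T * P = (sigmaMax T : ℂ) • Q
  map_left : Tᴴ * Q = (sigmaMax T : ℂ) • P
  complete : ∀ v : i → ℂ, (Tᴴ * T) *ᵥ v = ((sigmaMax T : ℂ) ^ 2) • v → ∃ c : k → ℂ, v = P *ᵥ c

section ClosedLoop

variable {m nx nK m₁ p₁ m₂ p₂ : ℕ} {r : Fin m → ℕ}

/-- Plants with inputs `(p, w, u)` and outputs `(q, z, y)`. -/
abbrev Plant (r : Fin m → ℕ) (nx m₁ p₁ m₂ p₂ : ℕ) : Type :=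
  StateSpace (Fin nx) ((Chan r ⊕ Fin m₁) ⊕ Fin m₂) ((Chan r ⊕ Fin p₁) ⊕ Fin p₂)

/-- Controllers with input `y` and output `u`. -/
abbrev Controller (nK m₂ p₂ : ℕ) : Type := StateSpace (Fin nK) (Fin p₂) (Fin m₂)

/-- The block matrix `[0 I; I Δ]`. -/
def uncertaintyBlock (r : Fin m → ℕ) (δ : EuclideanSpace ℝ (Fin m)) :
    Matrix (Chan r ⊕ Chan r) (Chan r ⊕ Chan r) ℝ :=
  Matrix.fromBlocks 0 1 1 (uncertainty r δ)

/-- The system `[0 I; I Δ] ⋆ M`, where `M = F_l(P, K)`. -/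
def closedLoop (P : Plant r nx m₁ p₁ m₂ p₂) (K : Controller nK m₂ p₂)
    (δ : EuclideanSpace ℝ (Fin m)) :
    StateSpace (Fin nx ⊕ Fin nK) (Chan r ⊕ Fin m₁) (Chan r ⊕ Fin p₁) :=
  StateSpace.star (uncertaintyBlock r δ) (P.lowerLFT K)

/-- The set `𝔻` of parameters for which the closed loop is internally stable: the uncertainty
loop is well-posed and the closed-loop state matrix `A(δ)` is Hurwitz. -/
def stableSet (P : Plant r nx m₁ p₁ m₂ p₂) (K : Controller nK m₂ p₂) :
    Set (EuclideanSpace ℝ (Fin m)) :=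
  {δ | StateSpace.StarWellPosed (uncertaintyBlock r δ) (P.lowerLFT K) ∧
    (closedLoop P K δ).IsHurwitz}

/-- `T_{qw}(δ, jω)`. -/
def Tqw (P : Plant r nx m₁ p₁ m₂ p₂) (K : Controller nK m₂ p₂)
    (δ : EuclideanSpace ℝ (Fin m)) (ω : ℝ≥0∞) : Matrix (Chan r) (Fin m₁) ℂ :=
  ((closedLoop P K δ).freqResponse ω).toBlocks₁₂

/-- `T_{zp}(δ, jω)`. -/
def Tzp (P : Plant r nx m₁ p₁ m₂ p₂) (K : Controller nK m₂ p₂)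
    (δ : EuclideanSpace ℝ (Fin m)) (ω : ℝ≥0∞) : Matrix (Fin p₁) (Chan r) ℂ :=
  ((closedLoop P K δ).freqResponse ω).toBlocks₂₁

/-- `T_{zw}(δ, jω)`. -/
def Tzw (P : Plant r nx m₁ p₁ m₂ p₂) (K : Controller nK m₂ p₂)
    (δ : EuclideanSpace ℝ (Fin m)) (ω : ℝ≥0∞) : Matrix (Fin p₁) (Fin m₁) ℂ :=
  ((closedLoop P K δ).freqResponse ω).toBlocks₂₂

/-- `h₋(δ) = -‖T_{zw}(δ)‖_∞`. -/
def hMinus (P : Plant r nx m₁ p₁ m₂ p₂) (K : Controller nK m₂ p₂)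
    (δ : EuclideanSpace ℝ (Fin m)) : ℝ :=
  -hinfNorm (Tzw P K δ)

/-- The matrix `Φ_Y = -∑_ω Re (T_{qw}(δ,jω) P_ω Y_ω Q_ωᴴ T_{zp}(δ,jω))ᵀ`, the sum being taken
over the finite set `F` of frequencies. -/
def PhiY (P : Plant r nx m₁ p₁ m₂ p₂) (K : Controller nK m₂ p₂)
    (δ : EuclideanSpace ℝ (Fin m)) {k : ℝ≥0∞ → ℕ}
    (Pω : ∀ ω : ℝ≥0∞, Matrix (Fin m₁) (Fin (k ω)) ℂ)
    (Qω : ∀ ω : ℝ≥0∞, Matrix (Fin p₁) (Fin (k ω)) ℂ)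
    (F : Finset ℝ≥0∞) (Y : ∀ ω : ℝ≥0∞, Matrix (Fin (k ω)) (Fin (k ω)) ℂ) :
    Matrix (Chan r) (Chan r) ℝ :=
  -∑ ω ∈ F, ((Tqw P K δ ω * Pω ω * Y ω * (Qω ω)ᴴ * Tzp P K δ ω).map Complex.re)ᵀ

/-- The vector `φ` with entries `Trace (Δ_iᵀ Φ)`. -/
def phiVec (Φ : Matrix (Chan r) (Chan r) ℝ) : EuclideanSpace ℝ (Fin m) :=
  WithLp.toLp 2 fun i => ((uncertaintyPartial r i)ᵀ * Φ).trace

end ClosedLoop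

/-- The Clarke directional derivative
`f°(x; d) = limsup_{x' → x, t ↓ 0} (f (x' + t d) - f x') / t`, as an extended real number
(it is finite when `f` is Lipschitz near `x`). -/
def clarkeDeriv {E : Type*} [NormedAddCommGroup E] [NormedSpace ℝ E]
    (f : E → ℝ) (x d : E) : EReal :=
  Filter.limsup (fun q : E × ℝ => (((f (q.1 + q.2 • d) - f q.1) / q.2 : ℝ) : EReal))
    (nhds x ×ˢ nhdsWithin (0 : ℝ) (Set.Ioi 0))

/-- The Clarke subdifferential `∂f(x) = {g | gᵀ d ≤ f°(x; d) for all d}`. -/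
def clarkeSubdiff {E : Type*} [NormedAddCommGroup E] [InnerProductSpace ℝ E]
    (f : E → ℝ) (x : E) : Set E :=
  {g | ∀ d : E, ((inner ℝ g d : ℝ) : EReal) ≤ clarkeDeriv f x d}

/-- `f` is Lipschitz on some neighbourhood of `x`. -/
def LipschitzNear {E : Type*} [NormedAddCommGroup E] (f : E → ℝ) (x : E) : Prop :=
  ∃ L : NNReal, ∃ U ∈ nhds x, LipschitzOnWith L f U

end Robust

end

/-! ### Clarke subdifferential of the negative of a maximum over a compact index set. -/

namespace Robust

open Filter Topology

/-! On the stable set, `‖T_zw(δ)‖_∞` is the maximum of `Re uᴴ T_zw(δ, jω) v` over the compact space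
of triples `(ω, u, v)` with `ω ∈ [0, ∞]` and `u`, `v` in the closed unit balls. Differentiability in
`δ` is replaced by an exact identity: `T_zw(δ') - T_zw(δ) = T_zp(δ') (Δ' - Δ) T_qw(δ)`
(`feedback_sub_feedback`, `Tzw_sub`). Every difference quotient is thus given by a slope that is
jointly continuous near the diagonal, which is what `IsMaxFamily` records.

For such a family compactness alone gives local Lipschitz continuity, and the Clarke subdifferential
of minus the maximum is the convex hull of minus the active gradients
(`IsMaxFamily.clarkeSubdiff_neg`). This hull is compact by Carathéodory.

Compactness in `ω` comes from the coordinate `ε = 1 / (1 + ω)`, in which the frequency response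
extends continuously to `ω = ∞`. Homogenising in the same way makes the Hurwitz property the
non-vanishing of a determinant on a compact set, hence an open condition.

If the norm is positive, equality in Cauchy–Schwarz identifies the active triples: `ω` is active, `u
= Q_ω c`, `v = P_ω c` with `|c| = 1` (`rePair_eq_sigmaMax_iff`). Their gradients correspond to the
rank-one weights `Y_ω = c cᴴ`, and by the spectral theorem convex combinations of these are exactly
the admissible `Y` (`convexHull_negTraceVec`). -/

theorem sum_eq_sum_of_embedding {ι κ V : Type*} [Fintype ι] [Fintype κ] [AddCommMonoid V]
    (e : ι ↪ κ) (g : κ → V) (g' : ι → V) (h : ∀ i, g (e i) = g' i)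
    (h0 : ∀ j, (¬∃ i, e i = j) → g j = 0) : ∑ j, g j = ∑ i, g' i := by
  rw [← Finset.sum_congr rfl fun i _ => h i, ← Finset.sum_map Finset.univ e g]
  exact (Finset.sum_subset (Finset.subset_univ _) fun j _ hj => h0 j (by simpa using hj)).symm

/-- In finite dimension the convex hull of a compact set is compact (Carathéodory). -/
theorem isCompact_convexHull_of_isCompact {E : Type*} [NormedAddCommGroup E] [NormedSpace ℝ E]
    [FiniteDimensional ℝ E] {A : Set E} (hA : IsCompact A) : IsCompact (convexHull ℝ A) := by
  rcases A.eq_empty_or_nonempty with rfl | ⟨a₀, ha₀⟩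
  · simp
  set N := Module.finrank ℝ E + 1
  have key : convexHull ℝ A =
      (fun p : (Fin N → ℝ) × (Fin N → E) => ∑ j, p.1 j • p.2 j) ''
        (stdSimplex ℝ (Fin N) ×ˢ Set.univ.pi fun _ => A) := by
    apply Set.Subset.antisymm
    · intro x hx
      obtain ⟨ι, _, z, w, hz, hind, hw, hw1, rfl⟩ := eq_pos_convex_span_of_mem_convexHull hx
      have hcard : Fintype.card ι ≤ Fintype.card (Fin N) := by
        rw [Fintype.card_fin]
        exact hind.card_le_finrank_succ.trans
          (Nat.succ_le_succ (Submodule.finrank_le _))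
      obtain ⟨e⟩ := Function.Embedding.nonempty_of_card_le hcard
      -- Fewer than `N` points are padded with weight `0` at `a₀`, so that the hull is the image of
      -- one fixed compact set.
      refine ⟨(Function.extend e w 0, Function.extend e z fun _ => a₀), ⟨⟨?_, ?_⟩, ?_⟩, ?_⟩
      · intro j
        by_cases hj : ∃ i, e i = j
        · obtain ⟨i, rfl⟩ := hj
          simpa [e.injective.extend_apply] using (hw i).le
        · simp [Function.extend_apply' _ _ _ hj]
      · rw [← hw1]
        exact sum_eq_sum_of_embedding e _ _ (fun i => e.injective.extend_apply _ _ _)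
          fun j hj => by simp [Function.extend_apply' _ _ _ hj]
      · intro j _
        by_cases hj : ∃ i, e i = j
        · obtain ⟨i, rfl⟩ := hj
          simpa [e.injective.extend_apply] using hz (Set.mem_range_self i)
        · simpa [Function.extend_apply' _ _ _ hj] using ha₀
      · exact sum_eq_sum_of_embedding e _ _ (fun i => by simp [e.injective.extend_apply])
          fun j hj => by simp [Function.extend_apply' _ _ _ hj]
    · rintro _ ⟨⟨w, z⟩, ⟨⟨hw, hw1⟩, hz⟩, rfl⟩
      exact (convex_convexHull ℝ A).sum_mem (fun i _ => hw i) hw1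
        fun i _ => subset_convexHull ℝ A (hz i (Set.mem_univ i))
  rw [key]
  exact ((isCompact_stdSimplex ℝ (Fin N)).prod (isCompact_univ_pi fun _ => hA)).image
    (by fun_prop)

/-- An intersection of half-spaces, for arbitrary `f`: a value `⊤` imposes no constraint and a value
`⊥` makes the set empty. -/
theorem convex_clarkeSubdiff {E : Type*} [NormedAddCommGroup E] [InnerProductSpace ℝ E]
    (f : E → ℝ) (x : E) : Convex ℝ (clarkeSubdiff f x) := by
  intro g hg h hh a b ha hb hab d
  have h1 := hg d
  have h2 := hh d
  generalize clarkeDeriv f x d = c at h1 h2 ⊢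
  induction c with
  | bot => simp at h1
  | top => exact le_top
  | coe c =>
    rw [EReal.coe_le_coe_iff] at h1 h2 ⊢
    rw [inner_add_left, real_inner_smul_left, real_inner_smul_left]
    calc _ ≤ a * c + b * c := by gcongr
      _ = c := by rw [← add_mul, hab, one_mul]

/-- `F` is, on the open set `U`, the maximum of a family of functions indexed by a compact space,
whose difference quotients are represented by a slope `G` continuous along the diagonal. -/
structure IsMaxFamily {E S : Type*} [NormedAddCommGroup E] [InnerProductSpace ℝ E]
    [TopologicalSpace S] (U : Set E) (F : E → ℝ) (f : E → S → ℝ) (G : E → E → S → E) : Prop where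
  isOpen : IsOpen U
  isLUB : ∀ x ∈ U, IsLUB (Set.range (f x)) (F x)
  slope : ∀ x ∈ U, ∀ y ∈ U, ∀ s, f y s - f x s = inner ℝ (G y x s) (y - x)
  continuousAt : ∀ x ∈ U, ∀ s, ContinuousAt (fun p : E × S => f p.1 p.2) (x, s)
  continuousAt_slope : ∀ x ∈ U, ∀ s,
    ContinuousAt (fun p : (E × E) × S => G p.1.1 p.1.2 p.2) ((x, x), s)

namespace IsMaxFamily

variable {E S : Type*} [NormedAddCommGroup E] [InnerProductSpace ℝ E]
  [TopologicalSpace S] {U : Set E} {F : E → ℝ} {f : E → S → ℝ}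
  {G : E → E → S → E}

/-- The gradients of the active members of the negated family. -/
def negActiveGrad (F : E → ℝ) (f : E → S → ℝ) (G : E → E → S → E) (x : E) : Set E :=
  (fun s => -G x x s) '' {s | f x s = F x}

theorem le (h : IsMaxFamily U F f G) {x : E} (hx : x ∈ U) (s : S) : f x s ≤ F x :=
  (h.isLUB x hx).1 ⟨s, rfl⟩

theorem continuous_apply (h : IsMaxFamily U F f G) {x : E} (hx : x ∈ U) : Continuous (f x) :=
  continuous_iff_continuousAt.2 fun s =>
    (h.continuousAt x hx s).comp (f := fun s => (x, s)) (by fun_prop)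

theorem continuous_slope_diag (h : IsMaxFamily U F f G) {x : E} (hx : x ∈ U) :
    Continuous (G x x) :=
  continuous_iff_continuousAt.2 fun s =>
    (h.continuousAt_slope x hx s).comp (f := fun s => ((x, x), s)) (by fun_prop)

/-- The limsup is tested along the base points `x - t d`. Since `s` is active at the end point `x`,
one has `F (x - t d) - F x ≥ f (x - t d) s - f x s`, and the right side is `t` times a slope tending
to the claimed value. -/
theorem inner_le_clarkeDeriv (h : IsMaxFamily U F f G) {x : E} (hx : x ∈ U) {s : S}
    (hs : f x s = F x) (d : E) :
    ((inner ℝ (-G x x s) d : ℝ) : EReal) ≤ clarkeDeriv (fun y => -F y) x d := by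
  have hpath : Tendsto (fun t : ℝ => x - t • d) (𝓝[>] 0) (𝓝 x) := by
    have : ContinuousAt (fun t : ℝ => x - t • d) 0 := by fun_prop
    simpa [ContinuousAt] using this.tendsto.mono_left (nhdsWithin_le_nhds (s := Set.Ioi 0))
  have htend : Tendsto (fun t : ℝ => ((inner ℝ (-G (x - t • d) x s) d : ℝ) : EReal)) (𝓝[>] 0)
      (𝓝 ((inner ℝ (-G x x s) d : ℝ) : EReal)) := by
    refine (continuous_coe_real_ereal.tendsto _).comp ?_
    have h1 : Tendsto (fun t : ℝ => G (x - t • d) x s) (𝓝[>] 0) (𝓝 (G x x s)) :=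
      (h.continuousAt_slope x hx s).tendsto.comp
        ((hpath.prodMk_nhds tendsto_const_nhds).prodMk_nhds tendsto_const_nhds)
    exact h1.neg.inner tendsto_const_nhds
  rw [← htend.limsup_eq]
  have hmap : Tendsto (fun t : ℝ => (x - t • d, t)) (𝓝[>] 0) (𝓝 x ×ˢ 𝓝[>] 0) :=
    hpath.prodMk tendsto_id
  refine le_trans ?_ (limsup_le_limsup_of_le hmap)
  rw [← limsup_comp]
  refine limsup_le_limsup ?_
  filter_upwards [hpath.eventually (h.isOpen.mem_nhds hx), self_mem_nhdsWithin] with t htU ht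
  have ht : 0 < t := ht
  have h1 := h.slope x hx _ htU s
  have h2 := h.le htU s
  simp only [Function.comp_apply, EReal.coe_le_coe_iff]
  rw [le_div_iff₀ ht]
  have h3 : x - t • d + t • d = x := by abel
  have h4 : x - t • d - x = -(t • d) := by abel
  rw [h4, inner_neg_right, real_inner_smul_right] at h1
  rw [h3, inner_neg_left]
  linarith

variable [CompactSpace S]

theorem exists_eq [Nonempty S] (h : IsMaxFamily U F f G) {x : E} (hx : x ∈ U) :
    ∃ s, f x s = F x := by
  obtain ⟨s, -, hs⟩ := isCompact_univ.exists_isMaxOn Set.univ_nonempty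
    (h.continuous_apply hx).continuousOn
  refine ⟨s, le_antisymm (h.le hx s) ((h.isLUB x hx).2 ?_)⟩
  rintro _ ⟨t, rfl⟩
  exact hs (Set.mem_univ t)

theorem exists_slope_bound (h : IsMaxFamily U F f G) {x : E} (hx : x ∈ U) :
    ∃ L : NNReal, ∀ᶠ p : E × E in 𝓝 (x, x), ∀ s, ‖G p.1 p.2 s‖ ≤ L := by
  obtain ⟨C, hC⟩ := (isCompact_range (h.continuous_slope_diag hx)).isBounded.exists_norm_le
  refine ⟨(C + 1).toNNReal, ?_⟩
  have := isCompact_univ.eventually_forall_of_forall_eventually (x₀ := (x, x))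
    (P := fun (p : E × E) (s : S) => ‖G p.1 p.2 s‖ ≤ (C + 1).toNNReal) (fun s _ => by
      have hs : ‖G x x s‖ < C + 1 := (hC _ ⟨s, rfl⟩).trans_lt (lt_add_one C)
      filter_upwards [(h.continuousAt_slope x hx s).norm.eventually_lt_const hs] with p hp
      exact hp.le.trans (Real.le_coe_toNNReal _))
  simpa using this

/-- An index active at `y` gives `F y = f y s ≤ f z s + L |y - z| ≤ F z + L |y - z|`, with `L`
uniform in `s`. -/
theorem lipschitzNear [Nonempty S] (h : IsMaxFamily U F f G) {x : E} (hx : x ∈ U) :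
    ∃ L : NNReal, ∃ V ∈ 𝓝 x, LipschitzOnWith L F V := by
  obtain ⟨L, hL⟩ := h.exists_slope_bound hx
  rw [nhds_prod_eq] at hL
  obtain ⟨V, hV, hVL⟩ := mem_prod_same_iff.1 hL
  refine ⟨L, V ∩ U, Filter.inter_mem hV (h.isOpen.mem_nhds hx), ?_⟩
  apply LipschitzOnWith.of_le_add_mul
  rintro y ⟨hyV, hyU⟩ z ⟨hzV, hzU⟩
  obtain ⟨s, hs⟩ := h.exists_eq hyU
  have h1 := h.slope z hzU y hyU s
  have h2 : inner ℝ (G y z s) (y - z) ≤ L * dist y z := by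
    rw [dist_eq_norm]
    exact (real_inner_le_norm _ _).trans
      (mul_le_mul_of_nonneg_right (hVL (Set.mk_mem_prod hyV hzV) s) (norm_nonneg _))
  linarith [h.le hzU s]

theorem continuousAt_max [Nonempty S] (h : IsMaxFamily U F f G) {x : E} (hx : x ∈ U) :
    ContinuousAt F x := by
  obtain ⟨L, V, hV, hF⟩ := h.lipschitzNear hx
  exact hF.continuousOn.continuousAt hV

theorem isCompact_negActiveGrad (h : IsMaxFamily U F f G) {x : E} (hx : x ∈ U) :
    IsCompact (negActiveGrad F f G x) :=
  ((isClosed_eq (h.continuous_apply hx) continuous_const).isCompact).image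
    (h.continuous_slope_diag hx).neg

/-- Here the active index is taken at the moving base point: if `f q s = F q` then `F q - F (q + t
d) ≤ f q s - f (q + t d) s`, a quotient controlled by the slope at `s`. -/
theorem clarkeDeriv_le [Nonempty S] (h : IsMaxFamily U F f G) {x : E} (hx : x ∈ U) {d : E} {c : ℝ}
    (hc : ∀ s, f x s = F x → inner ℝ (-G x x s) d < c) :
    clarkeDeriv (fun y => -F y) x d ≤ (c : EReal) := by
  have hpath : ContinuousAt (fun q : E × ℝ => q.1 + q.2 • d) (x, 0) := by fun_prop
  have hpath' : Tendsto (fun q : E × ℝ => q.1 + q.2 • d) (𝓝 (x, 0)) (𝓝 x) := by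
    simpa [ContinuousAt] using hpath.tendsto
  have hfst : Tendsto (fun q : E × ℝ => q.1) (𝓝 (x, 0)) (𝓝 x) :=
    continuous_fst.tendsto (x, (0 : ℝ))
  -- An index inactive at `x` stays inactive nearby, and one active at `x` keeps its slope value
  -- below `c`. Compactness makes the neighbourhood uniform in `s`.
  have key : ∀ᶠ q : E × ℝ in 𝓝 (x, 0), ∀ s ∈ (Set.univ : Set S),
      f q.1 s < F q.1 ∨ inner ℝ (-G (q.1 + q.2 • d) q.1 s) d < c := by
    apply isCompact_univ.eventually_forall_of_forall_eventually (P := fun (q : E × ℝ) (s : S) =>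
      f q.1 s < F q.1 ∨ inner ℝ (-G (q.1 + q.2 • d) q.1 s) d < c)
    intro s _
    rcases (h.le hx s).lt_or_eq with hs | hs
    · have h1 : Tendsto (fun p : (E × ℝ) × S => f p.1.1 p.2) (𝓝 ((x, 0), s)) (𝓝 (f x s)) :=
        (h.continuousAt x hx s).tendsto.comp (Continuous.tendsto'
          (f := fun p : (E × ℝ) × S => (p.1.1, p.2)) (by fun_prop) _ _ rfl)
      have h2 : Tendsto (fun p : (E × ℝ) × S => F p.1.1) (𝓝 ((x, 0), s)) (𝓝 (F x)) :=
        (h.continuousAt_max hx).tendsto.comp (Continuous.tendsto'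
          (f := fun p : (E × ℝ) × S => p.1.1) (by fun_prop) _ _ rfl)
      filter_upwards [h1.eventually_lt h2 hs] with p hp using Or.inl hp
    · have h1 : Tendsto (fun p : (E × ℝ) × S => G (p.1.1 + p.1.2 • d) p.1.1 p.2) (𝓝 ((x, 0), s))
          (𝓝 (G x x s)) :=
        (h.continuousAt_slope x hx s).tendsto.comp (Continuous.tendsto'
          (f := fun p : (E × ℝ) × S => ((p.1.1 + p.1.2 • d, p.1.1), p.2)) (by fun_prop) _ _
            (by simp))
      have h2 : Tendsto (fun p : (E × ℝ) × S => (inner ℝ (-G (p.1.1 + p.1.2 • d) p.1.1 p.2) d : ℝ))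
          (𝓝 ((x, 0), s)) (𝓝 (inner ℝ (-G x x s) d)) := h1.neg.inner tendsto_const_nhds
      filter_upwards [h2.eventually_lt_const (hc s hs)] with p hp using Or.inr hp
  refine limsup_le_of_le (h := ?_)
  have hle : 𝓝 x ×ˢ 𝓝[>] (0 : ℝ) ≤ 𝓝 (x, 0) := by
    rw [nhds_prod_eq]
    exact Filter.prod_mono le_rfl nhdsWithin_le_nhds
  have hpos : ∀ᶠ q : E × ℝ in 𝓝 x ×ˢ 𝓝[>] (0 : ℝ), 0 < q.2 :=
    tendsto_snd.eventually (self_mem_nhdsWithin : Set.Ioi (0 : ℝ) ∈ 𝓝[>] 0)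
  filter_upwards [hle key, hle (hpath'.eventually (h.isOpen.mem_nhds hx)),
    hle (hfst.eventually (h.isOpen.mem_nhds hx)), hpos] with q hq hqU' hqU hq0
  obtain ⟨s, hs⟩ := h.exists_eq hqU
  have hlt := (hq s (Set.mem_univ s)).resolve_left (by rw [hs]; exact lt_irrefl _)
  rw [EReal.coe_le_coe_iff, div_le_iff₀ hq0]
  have h1 := h.slope _ hqU _ hqU' s
  have h2 := h.le hqU' s
  rw [add_sub_cancel_left, real_inner_smul_right] at h1
  rw [inner_neg_left] at hlt
  nlinarith

/-- The Clarke subdifferential of the negative of a maximum of a compact family. -/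
theorem clarkeSubdiff_neg [Nonempty S] [FiniteDimensional ℝ E] (h : IsMaxFamily U F f G) {x : E}
    (hx : x ∈ U) :
    clarkeSubdiff (fun y => -F y) x = convexHull ℝ (negActiveGrad F f G x) := by
  apply Set.Subset.antisymm
  · intro g hg
    by_contra hgA
    -- A point outside the hull is strictly separated from it. The Riesz representative `d` of `l`
    -- is a direction with Clarke derivative at most `c < ⟨g, d⟩`.
    obtain ⟨l, c, hlA, hlg⟩ := geometric_hahn_banach_closed_point (convex_convexHull ℝ _)
      (isCompact_convexHull_of_isCompact (h.isCompact_negActiveGrad hx)).isClosed hgA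
    set d := (InnerProductSpace.toDual ℝ E).symm l
    have hl : ∀ y, l y = inner ℝ y d := fun y => by
      rw [real_inner_comm, InnerProductSpace.toDual_symm_apply]
    have := (hg d).trans (h.clarkeDeriv_le hx (d := d) (c := c) fun s hs => by
      rw [← hl]
      exact hlA _ (subset_convexHull ℝ _ ⟨s, hs, rfl⟩))
    rw [EReal.coe_le_coe_iff, ← hl] at this
    linarith
  · refine convexHull_min ?_ (convex_clarkeSubdiff _ _)
    rintro _ ⟨s, hs, rfl⟩ d
    exact h.inner_le_clarkeDeriv hx hs d

end IsMaxFamily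

end Robust

namespace Robust

open Filter Topology

/-! ### The exact difference formula for two feedback gains. -/

section Algebra

variable {R n κ i o : Type*} [CommRing R] [Fintype n] [DecidableEq n] [Fintype κ] [DecidableEq κ]

/-- The push-through identity, from `(1 - XY) X = X (1 - YX)`. -/
theorem mul_inv_one_sub_mul_comm (X Y : Matrix κ κ R) (h : IsUnit (1 - X * Y).det) :
    X * (1 - Y * X)⁻¹ = (1 - X * Y)⁻¹ * X := by
  have h' : IsUnit (1 - Y * X).det := by rwa [← Matrix.det_one_sub_mul_comm]
  have h1 : (1 - X * Y) * X = X * (1 - Y * X) := by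
    rw [Matrix.sub_mul, Matrix.mul_sub, Matrix.one_mul, Matrix.mul_one, Matrix.mul_assoc]
  calc X * (1 - Y * X)⁻¹ = (1 - X * Y)⁻¹ * ((1 - X * Y) * X) * (1 - Y * X)⁻¹ := by
        rw [Matrix.nonsing_inv_mul_cancel_left _ _ h]
    _ = (1 - X * Y)⁻¹ * X := by
        rw [h1, ← Matrix.mul_assoc, Matrix.mul_nonsing_inv_cancel_right _ _ h']

/-- Closing the loop `p = Δ q` around a block system with pencil `Λ`: the change of the transfer
matrix from the exogenous input to the exogenous output under a change of `Δ`. -/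
theorem feedback_sub_feedback (Λ : Matrix n n R) (B₁ : Matrix n κ R) (B₂ : Matrix n i R)
    (C₁ : Matrix κ n R) (C₂ : Matrix o n R) (D₁₁ : Matrix κ κ R) (D₁₂ : Matrix κ i R)
    (D₂₁ : Matrix o κ R) (D₂₂ : Matrix o i R) (Δ Δ' : Matrix κ κ R)
    (h : IsUnit (1 - Δ * D₁₁).det) (h' : IsUnit (1 - Δ' * D₁₁).det)
    (hW : IsUnit (Λ - B₁ * (1 - Δ * D₁₁)⁻¹ * Δ * C₁).det)
    (hW' : IsUnit (Λ - B₁ * (1 - Δ' * D₁₁)⁻¹ * Δ' * C₁).det) :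
    ((C₂ + D₂₁ * (1 - Δ' * D₁₁)⁻¹ * Δ' * C₁) * (Λ - B₁ * (1 - Δ' * D₁₁)⁻¹ * Δ' * C₁)⁻¹ *
        (B₂ + B₁ * (1 - Δ' * D₁₁)⁻¹ * Δ' * D₁₂) + (D₂₂ + D₂₁ * (1 - Δ' * D₁₁)⁻¹ * Δ' * D₁₂)) -
      ((C₂ + D₂₁ * (1 - Δ * D₁₁)⁻¹ * Δ * C₁) * (Λ - B₁ * (1 - Δ * D₁₁)⁻¹ * Δ * C₁)⁻¹ *
        (B₂ + B₁ * (1 - Δ * D₁₁)⁻¹ * Δ * D₁₂) + (D₂₂ + D₂₁ * (1 - Δ * D₁₁)⁻¹ * Δ * D₁₂)) =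
    ((C₂ + D₂₁ * (1 - Δ' * D₁₁)⁻¹ * Δ' * C₁) * (Λ - B₁ * (1 - Δ' * D₁₁)⁻¹ * Δ' * C₁)⁻¹ *
        (B₁ * (1 - Δ' * D₁₁)⁻¹) + D₂₁ * (1 - Δ' * D₁₁)⁻¹) * (Δ' - Δ) *
      ((1 - D₁₁ * Δ)⁻¹ * C₁ * (Λ - B₁ * (1 - Δ * D₁₁)⁻¹ * Δ * C₁)⁻¹ *
        (B₂ + B₁ * (1 - Δ * D₁₁)⁻¹ * Δ * D₁₂) + (1 - D₁₁ * Δ)⁻¹ * D₁₂) := by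
  have hS : IsUnit (1 - D₁₁ * Δ).det := by rwa [← Matrix.det_one_sub_mul_comm]
  have hcomm := mul_inv_one_sub_mul_comm Δ D₁₁ h
  have hSinv := Matrix.mul_nonsing_inv _ hS
  have hRinv := Matrix.nonsing_inv_mul _ h'
  set Q := (1 - Δ * D₁₁)⁻¹
  set Q' := (1 - Δ' * D₁₁)⁻¹
  set S := (1 - D₁₁ * Δ)⁻¹
  have hX := Matrix.mul_nonsing_inv_cancel_left _ (B₂ + B₁ * Q * Δ * D₁₂) hW
  have hL := Matrix.nonsing_inv_mul_cancel_right _ (C₂ + D₂₁ * Q' * Δ' * C₁) hW'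
  set L := (C₂ + D₂₁ * Q' * Δ' * C₁) * (Λ - B₁ * Q' * Δ' * C₁)⁻¹
  simp only [Matrix.mul_assoc _ (Λ - B₁ * Q * Δ * C₁)⁻¹ _]
  set X := (Λ - B₁ * Q * Δ * C₁)⁻¹ * (B₂ + B₁ * Q * Δ * D₁₂)
  clear_value L X
  -- `q` is the response at the input of `Δ`, and `π` is the dual response for `Δ'`. Equations
  -- `e1`–`e4` are the primal and dual loop equations without inverses. Eliminating `C₂ X` and `D₂₁
  -- Δ q` through the dual ones leaves only `π (Δ' - Δ) q`.
  set q := S * (C₁ * X + D₁₂) with hq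
  set π := (L * B₁ + D₂₁) * Q' with hπ
  have e1 : L * Λ = C₂ + π * Δ' * C₁ := by
    rw [Matrix.mul_sub, sub_eq_iff_eq_add] at hL
    rw [hL, hπ]
    simp only [Matrix.add_mul, Matrix.mul_assoc]
    abel
  have e5 : Δ * q = Q * Δ * (C₁ * X + D₁₂) := by rw [hq, ← Matrix.mul_assoc, hcomm]
  have e2 : Λ * X = B₁ * (Δ * q) + B₂ := by
    rw [Matrix.sub_mul, sub_eq_iff_eq_add] at hX
    rw [hX, e5]
    simp only [Matrix.mul_add, Matrix.mul_assoc]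
    abel
  have e3 : q = C₁ * X + D₁₁ * (Δ * q) + D₁₂ := by
    have : (1 - D₁₁ * Δ) * q = C₁ * X + D₁₂ := by rw [hq, ← Matrix.mul_assoc, hSinv, Matrix.one_mul]
    rw [Matrix.sub_mul, Matrix.one_mul, sub_eq_iff_eq_add] at this
    rw [← Matrix.mul_assoc, add_right_comm]
    exact this
  have e4 : π = π * Δ' * D₁₁ + L * B₁ + D₂₁ := by
    have : π * (1 - Δ' * D₁₁) = L * B₁ + D₂₁ := by rw [hπ, Matrix.mul_assoc, hRinv, Matrix.mul_one]
    rw [Matrix.mul_sub, Matrix.mul_one, sub_eq_iff_eq_add, ← Matrix.mul_assoc] at this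
    rw [add_assoc, add_comm, ← this]
  have e6 : (C₂ + D₂₁ * Q * Δ * C₁) * X + (D₂₂ + D₂₁ * Q * Δ * D₁₂) =
      C₂ * X + D₂₁ * (Δ * q) + D₂₂ := by
    rw [e5]
    simp only [Matrix.mul_add, Matrix.add_mul, Matrix.mul_assoc]
    abel
  have e7 : L * (B₂ + B₁ * Q' * Δ' * D₁₂) + (D₂₂ + D₂₁ * Q' * Δ' * D₁₂) =
      L * B₂ + π * Δ' * D₁₂ + D₂₂ := by
    rw [hπ]
    simp only [Matrix.mul_add, Matrix.add_mul, Matrix.mul_assoc]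
    abel
  have e8 : L * (B₁ * Q') + D₂₁ * Q' = π := by
    rw [hπ, Matrix.add_mul, Matrix.mul_assoc]
  have e9 : S * (C₁ * X) + S * D₁₂ = q := by rw [hq, Matrix.mul_add]
  have f1 : C₂ * X = L * (Λ * X) - π * Δ' * (C₁ * X) := by
    rw [← Matrix.mul_assoc L, e1, Matrix.add_mul, Matrix.mul_assoc _ C₁, add_sub_cancel_right]
  have f2 : D₂₁ * (Δ * q) = π * (Δ * q) - π * Δ' * (D₁₁ * (Δ * q)) - L * (B₁ * (Δ * q)) := by
    have : D₂₁ = π - π * Δ' * D₁₁ - L * B₁ := by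
      rw [sub_sub, eq_sub_iff_add_eq']
      exact e4.symm
    conv_lhs => rw [this]
    simp only [Matrix.sub_mul, Matrix.mul_assoc]
  have f3 : π * Δ' * q = π * Δ' * (C₁ * X) + π * Δ' * (D₁₁ * (Δ * q)) + π * Δ' * D₁₂ := by
    nth_rewrite 1 [e3]
    simp only [Matrix.mul_add]
  rw [e6, e7, e8, Matrix.mul_assoc S C₁ X, e9, f1, e2, f2, Matrix.mul_sub π, Matrix.sub_mul, f3,
    Matrix.mul_assoc π Δ q, Matrix.mul_add L]
  abel

end Algebra

/-! ### Hurwitz stability and frequency responses on the compactified frequency axis. -/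

section Pencil

theorem pencil_smul {n : Type*} [DecidableEq n] (c s : ℂ) (A : Matrix n n ℂ) :
    (c * s) • (1 : Matrix n n ℂ) - c • A = c • (s • 1 - A) := by
  rw [smul_sub, smul_smul]

theorem _root_.ContinuousAt.matrix_mul {a b c Ξ 𝕜 : Type*} [Fintype b] [TopologicalSpace Ξ]
    [NormedField 𝕜] {f : Ξ → Matrix a b 𝕜} {g : Ξ → Matrix b c 𝕜} {x : Ξ}
    (hf : ContinuousAt f x) (hg : ContinuousAt g x) : ContinuousAt (fun y => f y * g y) x :=
  ContinuousAt.comp (g := fun p : Matrix a b 𝕜 × Matrix b c 𝕜 => p.1 * p.2)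
    (continuous_fst.matrix_mul continuous_snd).continuousAt (hf.prodMk hg)

/-- The coordinate `1 / (1 + ω)` on `[0, ∞]`. -/
noncomputable def invFreq (ω : ℝ≥0∞) : ℝ := ((1 + ω)⁻¹).toReal

theorem continuous_invFreq : Continuous invFreq := by
  refine continuous_iff_continuousAt.2 fun ω => ?_
  refine (ENNReal.tendsto_toReal (a := (1 + ω)⁻¹) (by simp)).comp ?_
  exact Continuous.tendsto (f := fun ω : ℝ≥0∞ => (1 + ω)⁻¹) (by fun_prop) ω

/-- The pencil `ε (jω I - A)`, `ε = 1 / (1 + ω)`, extended continuously to `ω = ∞`. -/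
noncomputable def freqPencil {n : Type*} [DecidableEq n] (A : Matrix n n ℝ) (ω : ℝ≥0∞) : Matrix n n ℂ :=
  (((1 - invFreq ω : ℝ) : ℂ) * Complex.I) • (1 : Matrix n n ℂ) - (invFreq ω : ℂ) • toC A

theorem continuousAt_toC_fst {a b Ξ : Type*} [TopologicalSpace Ξ]
    {g : Ξ → Matrix a b ℝ} {x : Ξ} (hg : ContinuousAt g x) (ω : ℝ≥0∞) : ContinuousAt (fun p : Ξ × ℝ≥0∞ => toC (g p.1)) (x, ω) := by
  have h1 : ContinuousAt (fun p : Ξ × ℝ≥0∞ => g p.1) (x, ω) :=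
    ContinuousAt.comp (f := Prod.fst) hg continuousAt_fst
  have h2 : Continuous fun M : Matrix a b ℝ => toC M :=
    continuous_id.matrix_map Complex.continuous_ofReal
  exact h2.continuousAt.comp h1

theorem continuousAt_freqPencil {n Ξ : Type*} [DecidableEq n] [TopologicalSpace Ξ]
    {A : Ξ → Matrix n n ℝ} {x : Ξ} (hA : ContinuousAt A x)
    (ω : ℝ≥0∞) : ContinuousAt (fun p : Ξ × ℝ≥0∞ => freqPencil (A p.1) p.2) (x, ω) := by
  have hε : Continuous fun p : Ξ × ℝ≥0∞ => invFreq p.2 := continuous_invFreq.comp continuous_snd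
  have hε' : Continuous fun p : Ξ × ℝ≥0∞ => (invFreq p.2 : ℂ) := Complex.continuous_ofReal.comp hε
  have hθ : Continuous fun p : Ξ × ℝ≥0∞ => ((1 - invFreq p.2 : ℝ) : ℂ) * Complex.I :=
    (Complex.continuous_ofReal.comp (continuous_const.sub hε)).mul continuous_const
  exact ((hθ.smul continuous_const).continuousAt).sub
    (hε'.continuousAt.smul (continuousAt_toC_fst hA ω))

variable {n i o Ξ : Type*} [Fintype n] [DecidableEq n] [TopologicalSpace Ξ]

/-- Homogeneous coordinates `(ε, s)` for the points `s / ε` of the closed right half plane with a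
point at infinity adjoined. -/
def halfPlaneCoords : Set (ℝ × ℂ) := {p | 0 ≤ p.1 ∧ 0 ≤ p.2.re ∧ p.1 + ‖p.2‖ = 1}

theorem isCompact_halfPlaneCoords : IsCompact halfPlaneCoords := by
  refine ((isCompact_Icc (a := (0 : ℝ)) (b := 1)).prod
    (isCompact_closedBall (0 : ℂ) 1)).of_isClosed_subset ?_ ?_
  · have h1 : IsClosed {p : ℝ × ℂ | 0 ≤ p.1} := isClosed_le continuous_const continuous_fst
    have h2 : IsClosed {p : ℝ × ℂ | 0 ≤ p.2.re} :=
      isClosed_le continuous_const (Complex.continuous_re.comp continuous_snd)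
    have h3 : IsClosed {p : ℝ × ℂ | p.1 + ‖p.2‖ = 1} :=
      isClosed_eq (continuous_fst.add continuous_snd.norm) continuous_const
    exact h1.inter (h2.inter h3)
  · rintro ⟨ε, s⟩ ⟨h1, -, h2⟩
    simp only at h1 h2
    have := norm_nonneg s
    simp only [Set.mem_prod, Set.mem_Icc, Metric.mem_closedBall, dist_zero_right]
    refine ⟨⟨h1, ?_⟩, ?_⟩ <;> linarith

/-- A point with `ε > 0` tests `s / ε` as an eigenvalue. At `ε = 0` the pencil is `s • 1` with `|s|
= 1`, so infinity adds no condition. Stability becomes a condition on a compact set. -/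
theorem isHurwitz_iff (G : StateSpace n i o) : G.IsHurwitz ↔
    ∀ p ∈ halfPlaneCoords, (p.2 • (1 : Matrix n n ℂ) - (p.1 : ℂ) • toC G.A).det ≠ 0 := by
  have hspec : ∀ z : ℂ, z ∈ spectrum ℂ (toC G.A) ↔
      (z • (1 : Matrix n n ℂ) - toC G.A).det = 0 := fun z => by
    rw [spectrum.mem_iff, Algebra.algebraMap_eq_smul_one, Matrix.isUnit_iff_isUnit_det,
      isUnit_iff_ne_zero, not_not]
  constructor
  · rintro hG ⟨ε, s⟩ ⟨hε, hs, h1⟩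
    simp only at hε hs h1 ⊢
    rcases hε.eq_or_lt with rfl | hε
    · have hs0 : s ≠ 0 := by
        rintro rfl
        simp at h1
      simp [hs0]
    · intro hdet
      have hε' : (ε : ℂ) ≠ 0 := by exact_mod_cast hε.ne'
      have h2 : s = ε * (s / ε) := by field_simp
      rw [h2, pencil_smul, Matrix.det_smul] at hdet
      have h3 := hG _ ((hspec _).2 ((mul_eq_zero.1 hdet).resolve_left (pow_ne_zero _ hε')))
      rw [Complex.div_ofReal_re] at h3
      exact absurd h3 (not_lt.2 (div_nonneg hs hε.le))
  · intro h z hz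
    by_contra! hre
    rw [hspec] at hz
    have hpos : 0 < 1 + ‖z‖ := by positivity
    -- The coordinates `(1, z)` normalised to `ε + |s| = 1`.
    refine h (1 / (1 + ‖z‖), ((1 / (1 + ‖z‖) : ℝ) : ℂ) * z) ⟨by positivity, ?_, ?_⟩ ?_
    · simp only [Complex.re_ofReal_mul]
      positivity
    · simp only [norm_mul, Complex.norm_real, Real.norm_eq_abs]
      rw [abs_of_pos (by positivity)]
      field_simp
    · simp only
      rw [pencil_smul, Matrix.det_smul, hz, mul_zero]

/-- A determinant non-vanishing on a compact set stays so under small perturbation; no continuity of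
eigenvalues is needed. -/
theorem eventually_isHurwitz {G : Ξ → StateSpace n i o} {x : Ξ}
    (hA : ContinuousAt (fun y => (G y).A) x) (hG : (G x).IsHurwitz) :
    ∀ᶠ y in 𝓝 x, (G y).IsHurwitz := by
  rw [isHurwitz_iff] at hG
  simp only [isHurwitz_iff]
  apply isCompact_halfPlaneCoords.eventually_forall_of_forall_eventually
    (P := fun y p => (p.2 • (1 : Matrix n n ℂ) - (p.1 : ℂ) • toC (G y).A).det ≠ 0)
  intro p hp
  have hc : Continuous fun q : Matrix n n ℝ × (ℝ × ℂ) =>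
      (q.2.2 • (1 : Matrix n n ℂ) - (q.2.1 : ℂ) • toC q.1).det := by
    have h1 : Continuous fun q : Matrix n n ℝ × (ℝ × ℂ) => toC q.1 :=
      continuous_fst.matrix_map Complex.continuous_ofReal
    have h2 : Continuous fun q : Matrix n n ℝ × (ℝ × ℂ) => (q.2.1 : ℂ) :=
      Complex.continuous_ofReal.comp (continuous_fst.comp continuous_snd)
    have h3 : Continuous fun q : Matrix n n ℝ × (ℝ × ℂ) => q.2.2 :=
      continuous_snd.comp continuous_snd
    exact ((h3.smul continuous_const).sub (h2.smul h1)).matrix_det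
  have h2 : ContinuousAt (fun q : Ξ × (ℝ × ℂ) => ((G q.1).A, q.2)) (x, p) :=
    (hA.comp (x := (x, p)) (f := Prod.fst) continuousAt_fst).prodMk continuousAt_snd
  exact (hc.continuousAt.comp (x := (x, p)) h2).eventually_ne (hG p hp)

theorem invFreq_mem (ω : ℝ≥0∞) : 0 ≤ invFreq ω ∧ invFreq ω ≤ 1 := by
  refine ⟨ENNReal.toReal_nonneg, ?_⟩
  rw [invFreq, ← ENNReal.toReal_one]
  exact ENNReal.toReal_mono (by simp) (by simp)

/-- The extended imaginary half-axis consists of the points `(ε, (1 - ε) j)` of `halfPlaneCoords`.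
-/
theorem det_freqPencil_ne_zero {G : StateSpace n i o} (hG : G.IsHurwitz) (ω : ℝ≥0∞) :
    (freqPencil G.A ω).det ≠ 0 := by
  obtain ⟨h0, h1⟩ := invFreq_mem ω
  refine (isHurwitz_iff G).1 hG (invFreq ω, ((1 - invFreq ω : ℝ) : ℂ) * Complex.I) ⟨h0, ?_, ?_⟩
  · simp
  · simp only [norm_mul, Complex.norm_real, Complex.norm_I, Real.norm_eq_abs]
    rw [abs_of_nonneg (by linarith)]
    ring

/-- Scaling both the pencil and the input matrix by `ε` changes nothing for finite `ω`; at `ω = ∞`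
the factor `ε = 0` leaves only the feedthrough. This form is visibly continuous at `∞`. -/
theorem freqResponse_eq {G : StateSpace n i o} (hG : G.IsHurwitz) (ω : ℝ≥0∞) :
    G.freqResponse ω =
      toC G.C * (freqPencil G.A ω)⁻¹ * ((invFreq ω : ℂ) • toC G.B) + toC G.D := by
  induction ω with
  | top => simp [StateSpace.freqResponse, invFreq]
  | coe ω =>
    have hω : invFreq (ω : ℝ≥0∞) = (1 + (ω : ℝ))⁻¹ := by
      simp [invFreq, ENNReal.toReal_inv, ENNReal.toReal_add]
    have hpos : (0 : ℝ) < 1 + ω := by positivity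
    have hne : (invFreq ω : ℂ) ≠ 0 := by
      rw [hω]
      exact_mod_cast (inv_pos.2 hpos).ne'
    have hθ : ((1 - invFreq ω : ℝ) : ℂ) = (invFreq ω : ℂ) * (ω : ℝ) := by
      rw [← Complex.ofReal_mul, hω]
      congr 1
      field_simp
      ring
    have h1 : freqPencil G.A ω = (invFreq ω : ℂ) • (((ω : ℝ) * Complex.I) • 1 - toC G.A) := by
      rw [freqPencil, ← pencil_smul, hθ, mul_assoc]
    have hdet := det_freqPencil_ne_zero hG ω
    rw [h1, Matrix.det_smul] at hdet
    have hu : IsUnit ((((ω : ℝ) : ℂ) * Complex.I) • (1 : Matrix n n ℂ) - toC G.A).det :=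
      isUnit_iff_ne_zero.2 (right_ne_zero_of_mul hdet)
    have h2 : (freqPencil G.A ω)⁻¹ =
        (invFreq ω : ℂ)⁻¹ • (((ω : ℝ) * Complex.I) • (1 : Matrix n n ℂ) - toC G.A)⁻¹ := by
      rw [h1]
      exact Matrix.inv_smul' _ (Units.mk0 _ hne) hu
    rw [h2]
    simp only [Matrix.mul_smul, Matrix.smul_mul, smul_smul, mul_inv_cancel₀ hne, one_smul]
    simp [StateSpace.freqResponse, StateSpace.transfer]

theorem continuousAt_inv_of_det_ne_zero {𝕜 : Type*} [NormedField 𝕜] {M : Ξ → Matrix n n 𝕜} {x : Ξ}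
    (hM : ContinuousAt M x) (h : (M x).det ≠ 0) : ContinuousAt (fun y => (M y)⁻¹) x := by
  refine (continuousAt_matrix_inv (M x) ?_).comp hM
  rw [Ring.inverse_eq_inv']
  exact continuousAt_inv₀ h

theorem continuousAt_freqResponse {G : Ξ → StateSpace n i o} {x : Ξ}
    (hA : ContinuousAt (fun y => (G y).A) x) (hB : ContinuousAt (fun y => (G y).B) x)
    (hC : ContinuousAt (fun y => (G y).C) x) (hD : ContinuousAt (fun y => (G y).D) x)
    (hG : (G x).IsHurwitz) (ω : ℝ≥0∞) :
    ContinuousAt (fun p : Ξ × ℝ≥0∞ => (G p.1).freqResponse p.2) (x, ω) := by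
  have hH : ∀ᶠ p : Ξ × ℝ≥0∞ in 𝓝 (x, ω), (G p.1).IsHurwitz :=
    (continuousAt_fst (p := (x, ω))).eventually (eventually_isHurwitz hA hG)
  refine ContinuousAt.congr ?_ (hH.mono fun p hp => (freqResponse_eq hp p.2).symm)
  have hε : Continuous fun p : Ξ × ℝ≥0∞ => (invFreq p.2 : ℂ) :=
    Complex.continuous_ofReal.comp (continuous_invFreq.comp continuous_snd)
  have hinv := continuousAt_inv_of_det_ne_zero (continuousAt_freqPencil hA ω)
    (det_freqPencil_ne_zero hG ω)
  exact (((continuousAt_toC_fst hC ω).matrix_mul hinv).matrix_mul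
    (hε.continuousAt.smul (continuousAt_toC_fst hB ω))).add (continuousAt_toC_fst hD ω)

end Pencil

end Robust

namespace Robust

open Filter Topology

/-! ### Frequency responses of the loop `p = Δ q` as functions of `Δ`. -/

section RealToComplex

variable {a b c n : Type*}

theorem toC_add (M N : Matrix a b ℝ) : toC (M + N) = toC M + toC N := by
  ext; simp

theorem toC_mul [Fintype b] (M : Matrix a b ℝ) (N : Matrix b c ℝ) :
    toC (M * N) = toC M * toC N :=
  Matrix.map_mul (f := Complex.ofRealHom)

theorem toC_one_sub [DecidableEq n] (M : Matrix n n ℝ) : toC (1 - M) = 1 - toC M := by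
  ext i j
  by_cases h : i = j <;> simp [h]

theorem isUnit_det_toC [Fintype n] [DecidableEq n] {M : Matrix n n ℝ} (h : IsUnit M.det) :
    IsUnit (toC M).det := by
  have : (toC M).det = (M.det : ℂ) := (Complex.ofRealHom.map_det M).symm
  rw [this]
  exact h.map Complex.ofRealHom

theorem toC_inv [Fintype n] [DecidableEq n] {M : Matrix n n ℝ} (h : IsUnit M.det) :
    toC M⁻¹ = (toC M)⁻¹ := by
  symm
  apply Matrix.inv_eq_right_inv
  rw [← toC_mul, Matrix.mul_nonsing_inv _ h]
  exact Matrix.map_one _ Complex.ofReal_zero Complex.ofReal_one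

end RealToComplex

section Loop

variable {n κ i o : Type*} [Fintype n] [DecidableEq n] [Fintype κ] [DecidableEq κ]

/-- The system obtained by closing the loop `p = Δ q`. -/
noncomputable abbrev closeLoop (M : StateSpace n (κ ⊕ i) (κ ⊕ o)) (Δ : Matrix κ κ ℝ) :
    StateSpace n (κ ⊕ i) (κ ⊕ o) :=
  StateSpace.star (Matrix.fromBlocks 0 1 1 Δ : Matrix (κ ⊕ κ) (κ ⊕ κ) ℝ) M

/-- An instance of `feedback_sub_feedback` with `Λ = freqPencil M.A ω` and input matrices scaled by
`ε`, which treats finite and infinite frequencies at once. -/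
theorem freqResponse_closeLoop_sub (M : StateSpace n (κ ⊕ i) (κ ⊕ o)) {Δ Δ' : Matrix κ κ ℝ}
    (h : IsUnit (1 - Δ * M.D.toBlocks₁₁).det) (h' : IsUnit (1 - Δ' * M.D.toBlocks₁₁).det)
    (hH : (closeLoop M Δ).IsHurwitz) (hH' : (closeLoop M Δ').IsHurwitz) (ω : ℝ≥0∞) :
    ((closeLoop M Δ').freqResponse ω).toBlocks₂₂ - ((closeLoop M Δ).freqResponse ω).toBlocks₂₂ =
      ((closeLoop M Δ').freqResponse ω).toBlocks₂₁ * (toC Δ' - toC Δ) *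
        ((closeLoop M Δ).freqResponse ω).toBlocks₁₂ := by
  have pencil : ∀ {Δ : Matrix κ κ ℝ}, IsUnit (1 - Δ * M.D.toBlocks₁₁).det →
      freqPencil (closeLoop M Δ).A ω = freqPencil M.A ω - ((invFreq ω : ℂ) • toC M.B.toCols₁) *
        (1 - toC Δ * toC M.D.toBlocks₁₁)⁻¹ * toC Δ * toC M.C.toRows₁ := by
    intro Δ h
    simp only [closeLoop, StateSpace.star, freqPencil, Matrix.toBlocks_fromBlocks₂₂, toC_add,
      toC_mul, toC_inv h, toC_one_sub, smul_add, Matrix.smul_mul]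
    abel
  have b22 : ∀ {Δ : Matrix κ κ ℝ}, IsUnit (1 - Δ * M.D.toBlocks₁₁).det →
      (closeLoop M Δ).IsHurwitz → ((closeLoop M Δ).freqResponse ω).toBlocks₂₂ =
        (toC M.C.toRows₂ + toC M.D.toBlocks₂₁ * (1 - toC Δ * toC M.D.toBlocks₁₁)⁻¹ * toC Δ *
          toC M.C.toRows₁) * (freqPencil (closeLoop M Δ).A ω)⁻¹ *
        ((invFreq ω : ℂ) • toC M.B.toCols₂ + ((invFreq ω : ℂ) • toC M.B.toCols₁) *
          (1 - toC Δ * toC M.D.toBlocks₁₁)⁻¹ * toC Δ * toC M.D.toBlocks₁₂) +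
        (toC M.D.toBlocks₂₂ + toC M.D.toBlocks₂₁ * (1 - toC Δ * toC M.D.toBlocks₁₁)⁻¹ * toC Δ *
          toC M.D.toBlocks₁₂) := by
    intro Δ h hH
    have e : ((closeLoop M Δ).freqResponse ω).toBlocks₂₂ =
        toC (closeLoop M Δ).C.toRows₂ * (freqPencil (closeLoop M Δ).A ω)⁻¹ *
          ((invFreq ω : ℂ) • toC (closeLoop M Δ).B.toCols₂) + toC (closeLoop M Δ).D.toBlocks₂₂ := by
      rw [freqResponse_eq hH]
      rfl
    rw [e]
    generalize (freqPencil (closeLoop M Δ).A ω)⁻¹ = W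
    simp only [closeLoop, StateSpace.star, Matrix.toBlocks_fromBlocks₂₂,
      Matrix.toBlocks_fromBlocks₂₁, Matrix.toBlocks_fromBlocks₁₂, Matrix.toBlocks_fromBlocks₁₁,
      Matrix.toRows₂_fromRows, Matrix.toCols₂_fromCols, toC_add,
      toC_mul, toC_inv h, toC_one_sub, smul_add, Matrix.smul_mul]
  have b21 : ∀ {Δ : Matrix κ κ ℝ}, IsUnit (1 - Δ * M.D.toBlocks₁₁).det →
      (closeLoop M Δ).IsHurwitz → ((closeLoop M Δ).freqResponse ω).toBlocks₂₁ =
        (toC M.C.toRows₂ + toC M.D.toBlocks₂₁ * (1 - toC Δ * toC M.D.toBlocks₁₁)⁻¹ * toC Δ *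
          toC M.C.toRows₁) * (freqPencil (closeLoop M Δ).A ω)⁻¹ *
        (((invFreq ω : ℂ) • toC M.B.toCols₁) * (1 - toC Δ * toC M.D.toBlocks₁₁)⁻¹) +
        toC M.D.toBlocks₂₁ * (1 - toC Δ * toC M.D.toBlocks₁₁)⁻¹ := by
    intro Δ h hH
    have e : ((closeLoop M Δ).freqResponse ω).toBlocks₂₁ =
        toC (closeLoop M Δ).C.toRows₂ * (freqPencil (closeLoop M Δ).A ω)⁻¹ *
          ((invFreq ω : ℂ) • toC (closeLoop M Δ).B.toCols₁) + toC (closeLoop M Δ).D.toBlocks₂₁ := by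
      rw [freqResponse_eq hH]
      rfl
    rw [e]
    generalize (freqPencil (closeLoop M Δ).A ω)⁻¹ = W
    simp only [closeLoop, StateSpace.star, Matrix.toBlocks_fromBlocks₂₂,
      Matrix.toBlocks_fromBlocks₂₁, Matrix.toBlocks_fromBlocks₁₂, Matrix.toBlocks_fromBlocks₁₁,
      Matrix.toRows₂_fromRows, Matrix.toCols₁_fromCols, toC_add, Matrix.mul_one,
      toC_mul, toC_inv h, toC_one_sub, Matrix.smul_mul]
  have b12 : ∀ {Δ : Matrix κ κ ℝ}, IsUnit (1 - Δ * M.D.toBlocks₁₁).det →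
      (closeLoop M Δ).IsHurwitz → ((closeLoop M Δ).freqResponse ω).toBlocks₁₂ =
        (1 - toC M.D.toBlocks₁₁ * toC Δ)⁻¹ * toC M.C.toRows₁ *
          (freqPencil (closeLoop M Δ).A ω)⁻¹ *
        ((invFreq ω : ℂ) • toC M.B.toCols₂ + ((invFreq ω : ℂ) • toC M.B.toCols₁) *
          (1 - toC Δ * toC M.D.toBlocks₁₁)⁻¹ * toC Δ * toC M.D.toBlocks₁₂) +
        (1 - toC M.D.toBlocks₁₁ * toC Δ)⁻¹ * toC M.D.toBlocks₁₂ := by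
    intro Δ h hH
    have hS : IsUnit (1 - M.D.toBlocks₁₁ * Δ).det := by rwa [← Matrix.det_one_sub_mul_comm]
    have e : ((closeLoop M Δ).freqResponse ω).toBlocks₁₂ =
        toC (closeLoop M Δ).C.toRows₁ * (freqPencil (closeLoop M Δ).A ω)⁻¹ *
          ((invFreq ω : ℂ) • toC (closeLoop M Δ).B.toCols₂) + toC (closeLoop M Δ).D.toBlocks₁₂ := by
      rw [freqResponse_eq hH]
      rfl
    rw [e]
    generalize (freqPencil (closeLoop M Δ).A ω)⁻¹ = W
    simp only [closeLoop, StateSpace.star, Matrix.toBlocks_fromBlocks₂₂,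
      Matrix.toBlocks_fromBlocks₂₁, Matrix.toBlocks_fromBlocks₁₂, Matrix.toBlocks_fromBlocks₁₁,
      Matrix.toRows₁_fromRows, Matrix.toCols₂_fromCols, toC_add, Matrix.one_mul,
      toC_mul, toC_inv h, toC_inv hS, toC_one_sub, Matrix.smul_mul, smul_add]
  have hu : ∀ {Δ : Matrix κ κ ℝ}, IsUnit (1 - Δ * M.D.toBlocks₁₁).det →
      IsUnit (1 - toC Δ * toC M.D.toBlocks₁₁).det := fun h => by
    simpa only [toC_one_sub, toC_mul] using isUnit_det_toC h
  have hW := isUnit_iff_ne_zero.2 (det_freqPencil_ne_zero hH ω)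
  have hW' := isUnit_iff_ne_zero.2 (det_freqPencil_ne_zero hH' ω)
  rw [b22 h hH, b22 h' hH', b21 h' hH', b12 h hH]
  rw [pencil h] at hW ⊢
  rw [pencil h'] at hW' ⊢
  exact feedback_sub_feedback _ _ _ _ _ _ _ _ _ _ _ (hu h) (hu h') hW hW'

end Loop

section LoopContinuity

variable {n κ i o Ξ : Type*} [Fintype κ] [DecidableEq κ] [TopologicalSpace Ξ]

theorem _root_.ContinuousAt.matrix_fromCols {a b c : Type*} {f : Ξ → Matrix a b ℝ}
    {g : Ξ → Matrix a c ℝ} {x : Ξ} (hf : ContinuousAt f x) (hg : ContinuousAt g x) :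
    ContinuousAt (fun y => Matrix.fromCols (f y) (g y)) x := by
  have h : Continuous fun p : Matrix a b ℝ × Matrix a c ℝ => Matrix.fromCols p.1 p.2 := by
    refine continuous_matrix ?_
    rintro j (k | k)
    · exact continuous_fst.matrix_elem j k
    · exact continuous_snd.matrix_elem j k
  exact ContinuousAt.comp (g := fun p : Matrix a b ℝ × Matrix a c ℝ => Matrix.fromCols p.1 p.2)
    h.continuousAt (hf.prodMk hg)

theorem _root_.ContinuousAt.matrix_fromRows {a b c : Type*} {f : Ξ → Matrix a c ℝ}
    {g : Ξ → Matrix b c ℝ} {x : Ξ} (hf : ContinuousAt f x) (hg : ContinuousAt g x) :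
    ContinuousAt (fun y => Matrix.fromRows (f y) (g y)) x := by
  have h : Continuous fun p : Matrix a c ℝ × Matrix b c ℝ => Matrix.fromRows p.1 p.2 := by
    refine continuous_matrix ?_
    rintro (k | k) j
    · exact continuous_fst.matrix_elem k j
    · exact continuous_snd.matrix_elem k j
  exact ContinuousAt.comp (g := fun p : Matrix a c ℝ × Matrix b c ℝ => Matrix.fromRows p.1 p.2)
    h.continuousAt (hf.prodMk hg)

theorem continuousAt_closeLoop (M : StateSpace n (κ ⊕ i) (κ ⊕ o)) {Δ : Ξ → Matrix κ κ ℝ} {x : Ξ}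
    (hΔ : ContinuousAt Δ x) (h : IsUnit (1 - Δ x * M.D.toBlocks₁₁).det) :
    ContinuousAt (fun y => (closeLoop M (Δ y)).A) x ∧
      ContinuousAt (fun y => (closeLoop M (Δ y)).B) x ∧
      ContinuousAt (fun y => (closeLoop M (Δ y)).C) x ∧
      ContinuousAt (fun y => (closeLoop M (Δ y)).D) x := by
  have hR : ContinuousAt (fun y => (1 - Δ y * M.D.toBlocks₁₁)⁻¹) x :=
    continuousAt_inv_of_det_ne_zero (continuousAt_const.sub (hΔ.matrix_mul continuousAt_const))
      h.ne_zero
  have hS : ContinuousAt (fun y => (1 - M.D.toBlocks₁₁ * Δ y)⁻¹) x :=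
    continuousAt_inv_of_det_ne_zero (continuousAt_const.sub (continuousAt_const.matrix_mul hΔ))
      (by rw [← Matrix.det_one_sub_mul_comm]; exact h.ne_zero)
  refine ⟨?_, ?_, ?_, ?_⟩ <;>
    simp only [closeLoop, StateSpace.star, Matrix.toBlocks_fromBlocks₂₂,
      Matrix.toBlocks_fromBlocks₂₁, Matrix.toBlocks_fromBlocks₁₂, Matrix.toBlocks_fromBlocks₁₁,
      Matrix.mul_one, Matrix.one_mul, zero_add]
  · exact continuousAt_const.add
      (((continuousAt_const.matrix_mul hR).matrix_mul hΔ).matrix_mul continuousAt_const)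
  · exact (continuousAt_const.matrix_mul hR).matrix_fromCols (continuousAt_const.add
      (((continuousAt_const.matrix_mul hR).matrix_mul hΔ).matrix_mul continuousAt_const))
  · exact (hS.matrix_mul continuousAt_const).matrix_fromRows (continuousAt_const.add
      (((continuousAt_const.matrix_mul hR).matrix_mul hΔ).matrix_mul continuousAt_const))
  · have h1 := hS.matrix_mul (continuousAt_const (y := M.D.toBlocks₁₁))
    have h2 := hS.matrix_mul (continuousAt_const (y := M.D.toBlocks₁₂))
    have h3 := (continuousAt_const (y := M.D.toBlocks₂₁)).matrix_mul hR
    have h4 := (continuousAt_const (y := M.D.toBlocks₂₂)).add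
      ((h3.matrix_mul hΔ).matrix_mul (continuousAt_const (y := M.D.toBlocks₁₂)))
    have hb : Continuous fun p : (Matrix κ κ ℝ × Matrix κ i ℝ) × (Matrix o κ ℝ × Matrix o i ℝ) =>
        Matrix.fromBlocks p.1.1 p.1.2 p.2.1 p.2.2 :=
      (continuous_fst.comp continuous_fst).matrix_fromBlocks
        (continuous_snd.comp continuous_fst) (continuous_fst.comp continuous_snd)
        (continuous_snd.comp continuous_snd)
    exact ContinuousAt.comp
      (g := fun p : (Matrix κ κ ℝ × Matrix κ i ℝ) × (Matrix o κ ℝ × Matrix o i ℝ) =>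
        Matrix.fromBlocks p.1.1 p.1.2 p.2.1 p.2.2) hb.continuousAt
      ((h1.prodMk h2).prodMk (h3.prodMk h4))

end LoopContinuity

/-! ### The stable set and the dependence of the transfer blocks on `δ`. -/

section StableSet

variable {m nx nK m₁ p₁ m₂ p₂ : ℕ} {r : Fin m → ℕ}

theorem continuous_uncertainty : Continuous (uncertainty r) := by
  refine Continuous.matrix_diagonal (continuous_pi fun a => ?_)
  fun_prop

theorem isUnit_of_mem_stableSet {P : Plant r nx m₁ p₁ m₂ p₂} {K : Controller nK m₂ p₂}
    {δ : EuclideanSpace ℝ (Fin m)} (h : δ ∈ stableSet P K) :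
    IsUnit (1 - uncertainty r δ * (P.lowerLFT K).D.toBlocks₁₁).det := by
  simpa only [StateSpace.StarWellPosed, uncertaintyBlock, Matrix.toBlocks_fromBlocks₂₂] using h.1

theorem isOpen_stableSet (P : Plant r nx m₁ p₁ m₂ p₂) (K : Controller nK m₂ p₂) :
    IsOpen (stableSet P K) := by
  rw [isOpen_iff_mem_nhds]
  intro δ hδ
  have hu := isUnit_of_mem_stableSet hδ
  have hA := (continuousAt_closeLoop (P.lowerLFT K) (x := δ)
    (continuous_uncertainty (r := r)).continuousAt hu).1
  have hdet : Continuous fun δ : EuclideanSpace ℝ (Fin m) =>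
      (1 - uncertainty r δ * (P.lowerLFT K).D.toBlocks₁₁).det :=
    (continuous_const.sub (continuous_uncertainty.matrix_mul continuous_const)).matrix_det
  filter_upwards [hdet.continuousAt.eventually_ne hu.ne_zero, eventually_isHurwitz hA hδ.2]
    with δ' h1 h2
  refine ⟨?_, h2⟩
  simpa only [StateSpace.StarWellPosed, uncertaintyBlock, Matrix.toBlocks_fromBlocks₂₂] using
    isUnit_iff_ne_zero.2 h1

theorem continuousAt_closedLoop_freqResponse {P : Plant r nx m₁ p₁ m₂ p₂}
    {K : Controller nK m₂ p₂} {δ : EuclideanSpace ℝ (Fin m)} (hδ : δ ∈ stableSet P K) (ω : ℝ≥0∞) :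
    ContinuousAt (fun p : EuclideanSpace ℝ (Fin m) × ℝ≥0∞ =>
      (closedLoop P K p.1).freqResponse p.2) (δ, ω) := by
  obtain ⟨hA, hB, hC, hD⟩ := continuousAt_closeLoop (P.lowerLFT K) (x := δ)
    (continuous_uncertainty (r := r)).continuousAt (isUnit_of_mem_stableSet hδ)
  exact continuousAt_freqResponse hA hB hC hD hδ.2 ω

theorem continuousAt_Tzw {P : Plant r nx m₁ p₁ m₂ p₂}
    {K : Controller nK m₂ p₂} {δ : EuclideanSpace ℝ (Fin m)} (hδ : δ ∈ stableSet P K) (ω : ℝ≥0∞) :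
    ContinuousAt (fun p : EuclideanSpace ℝ (Fin m) × ℝ≥0∞ => Tzw P K p.1 p.2) (δ, ω) :=
  ContinuousAt.comp (g := Matrix.toBlocks₂₂) (continuous_id.matrix_submatrix _ _).continuousAt
    (continuousAt_closedLoop_freqResponse hδ ω)

theorem continuousAt_Tzp {P : Plant r nx m₁ p₁ m₂ p₂}
    {K : Controller nK m₂ p₂} {δ : EuclideanSpace ℝ (Fin m)} (hδ : δ ∈ stableSet P K) (ω : ℝ≥0∞) :
    ContinuousAt (fun p : EuclideanSpace ℝ (Fin m) × ℝ≥0∞ => Tzp P K p.1 p.2) (δ, ω) :=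
  ContinuousAt.comp (g := Matrix.toBlocks₂₁) (continuous_id.matrix_submatrix _ _).continuousAt
    (continuousAt_closedLoop_freqResponse hδ ω)

theorem continuousAt_Tqw {P : Plant r nx m₁ p₁ m₂ p₂}
    {K : Controller nK m₂ p₂} {δ : EuclideanSpace ℝ (Fin m)} (hδ : δ ∈ stableSet P K) (ω : ℝ≥0∞) :
    ContinuousAt (fun p : EuclideanSpace ℝ (Fin m) × ℝ≥0∞ => Tqw P K p.1 p.2) (δ, ω) :=
  ContinuousAt.comp (g := Matrix.toBlocks₁₂) (continuous_id.matrix_submatrix _ _).continuousAt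
    (continuousAt_closedLoop_freqResponse hδ ω)

theorem uncertainty_sub (δ δ' : EuclideanSpace ℝ (Fin m)) :
    toC (uncertainty r δ') - toC (uncertainty r δ) =
      ∑ j, ((δ' - δ) j : ℂ) • toC (uncertaintyPartial r j) := by
  ext a b
  by_cases hab : a = b
  · subst hab
    simp [uncertainty, uncertaintyPartial, Matrix.sum_apply, apply_ite]
  · simp [uncertainty, uncertaintyPartial, Matrix.sum_apply, hab]

/-- Exact, with no remainder, because `Δ` is linear in `δ`. The coefficients are the slopes of the
family. -/
theorem Tzw_sub {P : Plant r nx m₁ p₁ m₂ p₂} {K : Controller nK m₂ p₂}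
    {δ δ' : EuclideanSpace ℝ (Fin m)} (hδ : δ ∈ stableSet P K) (hδ' : δ' ∈ stableSet P K)
    (ω : ℝ≥0∞) :
    Tzw P K δ' ω - Tzw P K δ ω = ∑ j, ((δ' - δ) j : ℂ) •
      (Tzp P K δ' ω * toC (uncertaintyPartial r j) * Tqw P K δ ω) := by
  have h := freqResponse_closeLoop_sub (P.lowerLFT K) (isUnit_of_mem_stableSet hδ)
    (isUnit_of_mem_stableSet hδ') hδ.2 hδ'.2 ω
  rw [uncertainty_sub, Matrix.mul_sum, Matrix.sum_mul] at h
  simp only [Matrix.mul_smul, Matrix.smul_mul] at h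
  exact h

end StableSet

end Robust

namespace Robust

open Filter Topology

/-! ### The maximum singular value as a maximum of a bilinear pairing, and its maximisers. -/

section SingularVectors

variable {o i k : Type*} [Fintype o] [Fintype i]

/-- The real part of `uᴴ T v`. -/
def rePair (u : EuclideanSpace ℂ o) (T : Matrix o i ℂ) (v : EuclideanSpace ℂ i) : ℝ :=
  (star u.ofLp ⬝ᵥ (T *ᵥ v.ofLp)).re

theorem rePair_eq_inner (u : EuclideanSpace ℂ o) (T : Matrix o i ℂ) (v : EuclideanSpace ℂ i) :
    rePair u T v = RCLike.re (inner ℂ u (WithLp.toLp 2 (T *ᵥ v.ofLp))) := by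
  rw [EuclideanSpace.inner_eq_star_dotProduct, dotProduct_comm]
  rfl

theorem norm_toLp_sq (v : i → ℂ) :
    ((‖(WithLp.toLp 2 v : EuclideanSpace ℂ i)‖ ^ 2 : ℝ) : ℂ) = star v ⬝ᵥ v := by
  have := inner_self_eq_norm_sq_to_K (𝕜 := ℂ) (WithLp.toLp 2 v : EuclideanSpace ℂ i)
  rw [EuclideanSpace.inner_eq_star_dotProduct, dotProduct_comm] at this
  simpa using this.symm

theorem star_mulVec_dotProduct_mulVec {k : Type*} [Fintype k] (Q N P : Matrix _ _ ℂ) (c : k → ℂ) :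
    star (Q *ᵥ c : o → ℂ) ⬝ᵥ (N *ᵥ (P *ᵥ c : i → ℂ)) = star c ⬝ᵥ ((Qᴴ * N * P) *ᵥ c) := by
  rw [Matrix.star_mulVec, ← Matrix.dotProduct_mulVec, Matrix.mulVec_mulVec, Matrix.mulVec_mulVec,
    Matrix.mul_assoc]

theorem rePair_conjTranspose (u : EuclideanSpace ℂ o) (T : Matrix o i ℂ)
    (v : EuclideanSpace ℂ i) : rePair v Tᴴ u = rePair u T v := by
  have : star v.ofLp ⬝ᵥ (Tᴴ *ᵥ u.ofLp) = star (star u.ofLp ⬝ᵥ (T *ᵥ v.ofLp)) := by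
    rw [Matrix.star_dotProduct, Matrix.star_mulVec, Matrix.conjTranspose_conjTranspose,
      Matrix.dotProduct_mulVec]
  simp [rePair, this]

variable [DecidableEq i]

theorem norm_mulVec_le (T : Matrix o i ℂ) (v : EuclideanSpace ℂ i) :
    ‖(WithLp.toLp 2 (T *ᵥ v.ofLp) : EuclideanSpace ℂ o)‖ ≤ sigmaMax T * ‖v‖ :=
  (LinearMap.toContinuousLinearMap (Matrix.toEuclideanLin T)).le_opNorm v

theorem sigmaMax_nonneg (T : Matrix o i ℂ) : 0 ≤ sigmaMax T := norm_nonneg _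

theorem rePair_le (u : EuclideanSpace ℂ o) (T : Matrix o i ℂ) (v : EuclideanSpace ℂ i) :
    rePair u T v ≤ sigmaMax T * (‖u‖ * ‖v‖) := by
  rw [rePair_eq_inner]
  calc _ ≤ ‖u‖ * ‖(WithLp.toLp 2 (T *ᵥ v.ofLp) : EuclideanSpace ℂ o)‖ := re_inner_le_norm _ _
    _ ≤ ‖u‖ * (sigmaMax T * ‖v‖) := by gcongr; exact norm_mulVec_le T v
    _ = _ := by ring

theorem rePair_le_sigmaMax {u : EuclideanSpace ℂ o} (T : Matrix o i ℂ) {v : EuclideanSpace ℂ i}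
    (hu : ‖u‖ ≤ 1) (hv : ‖v‖ ≤ 1) : rePair u T v ≤ sigmaMax T :=
  (rePair_le u T v).trans (mul_le_of_le_one_right (sigmaMax_nonneg T)
    (mul_le_one₀ hu (norm_nonneg v) hv))

theorem sigmaMax_le {T : Matrix o i ℂ} {C : ℝ}
    (h : ∀ (u : EuclideanSpace ℂ o) (v : EuclideanSpace ℂ i), ‖u‖ ≤ 1 → ‖v‖ ≤ 1 →
      rePair u T v ≤ C) : sigmaMax T ≤ C := by
  have hC : 0 ≤ C := by simpa [rePair] using h 0 0 (by simp) (by simp)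
  refine ContinuousLinearMap.opNorm_le_of_unit_norm (𝕜 := ℂ) hC fun v hv => ?_
  set y : EuclideanSpace ℂ o := LinearMap.toContinuousLinearMap (Matrix.toEuclideanLin T) v with hy
  rcases eq_or_ne y 0 with h0 | h0
  · simpa [h0] using hC
  have hn : ‖y‖ ≠ 0 := norm_ne_zero_iff.2 h0
  -- The best `u` for a given `v` is `T v` normalised.
  have := h (((‖y‖⁻¹ : ℝ) : ℂ) • y) v (by rw [norm_smul]; simp [hn]) hv.le
  rw [rePair_eq_inner, inner_smul_left] at this
  have hyy : (inner ℂ y (WithLp.toLp 2 (T *ᵥ v.ofLp)) : ℂ) = ((‖y‖ ^ 2 : ℝ) : ℂ) := by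
    have : (WithLp.toLp 2 (T *ᵥ v.ofLp) : EuclideanSpace ℂ o) = y := rfl
    rw [this, inner_self_eq_norm_sq_to_K]
    simp
  rw [hyy, Complex.conj_ofReal, ← Complex.ofReal_mul] at this
  have h2 : ‖y‖⁻¹ * ‖y‖ ^ 2 = ‖y‖ := by field_simp
  rwa [h2] at this

/-- Equality in Cauchy–Schwarz: `‖y - σ u‖² ≤ σ² - 2 σ² + σ² = 0`. -/
theorem eq_smul_of_re_inner {V : Type*} [NormedAddCommGroup V] [InnerProductSpace ℂ V] {y u : V}
    {σ : ℝ} (hy : ‖y‖ ≤ σ) (hu : ‖u‖ ≤ 1) (h : RCLike.re (inner ℂ u y) = σ) : y = (σ : ℂ) • u := by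
  have hσ : 0 ≤ σ := (norm_nonneg y).trans hy
  rw [← sub_eq_zero, ← norm_eq_zero, ← sq_eq_zero_iff]
  refine le_antisymm ?_ (sq_nonneg _)
  have h1 := norm_sub_sq (𝕜 := ℂ) y ((σ : ℂ) • u)
  have h2 : RCLike.re (inner ℂ y ((σ : ℂ) • u)) = σ * σ := by
    have h3 : RCLike.re (inner ℂ y u) = σ := by rw [← h, inner_re_symm]
    rw [inner_smul_right, RCLike.re_eq_complex_re, Complex.re_ofReal_mul,
      ← RCLike.re_eq_complex_re, h3]
  rw [h2, norm_smul, Complex.norm_real, Real.norm_of_nonneg hσ] at h1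
  rw [h1]
  have h3 : ‖y‖ ^ 2 ≤ σ ^ 2 := by gcongr
  have h4 : (σ * ‖u‖) ^ 2 ≤ (σ * 1) ^ 2 := by gcongr
  nlinarith

theorem norm_conjTranspose_mulVec_le [DecidableEq o] (T : Matrix o i ℂ) (u : EuclideanSpace ℂ o) :
    ‖(WithLp.toLp 2 (Tᴴ *ᵥ u.ofLp) : EuclideanSpace ℂ i)‖ ≤ sigmaMax T * ‖u‖ := by
  refine (norm_mulVec_le Tᴴ u).trans (mul_le_mul_of_nonneg_right ?_ (norm_nonneg u))
  refine sigmaMax_le fun v u hv hu => ?_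
  rw [rePair_conjTranspose]
  exact rePair_le_sigmaMax T hu hv

theorem norm_mulVec_of_isometry {k : Type*} [Fintype k] [DecidableEq k] {P : Matrix i k ℂ}
    (hP : Pᴴ * P = 1) {c : k → ℂ} (hc : star c ⬝ᵥ c = 1) :
    ‖(WithLp.toLp 2 (P *ᵥ c) : EuclideanSpace ℂ i)‖ = 1 := by
  have h1 := norm_toLp_sq (P *ᵥ c)
  have h2 := star_mulVec_dotProduct_mulVec P 1 P c
  rw [Matrix.one_mulVec, Matrix.mul_one, hP, Matrix.one_mulVec, hc] at h2
  rw [h2] at h1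
  have h3 : ‖(WithLp.toLp 2 (P *ᵥ c) : EuclideanSpace ℂ i)‖ ^ 2 = 1 := by exact_mod_cast h1
  exact (pow_eq_one_iff_of_nonneg (norm_nonneg _) two_ne_zero).1 h3

/-- The pairs of vectors in the unit balls where `Re uᴴ T v` attains the maximum singular value. -/
theorem rePair_eq_sigmaMax_iff [DecidableEq o] [Fintype k] [DecidableEq k] {T : Matrix o i ℂ}
    {P : Matrix i k ℂ} {Q : Matrix o k ℂ} (h : IsMaxSingularPair T P Q) (hσ : 0 < sigmaMax T)
    (u : EuclideanSpace ℂ o) (v : EuclideanSpace ℂ i) :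
    (‖u‖ ≤ 1 ∧ ‖v‖ ≤ 1 ∧ rePair u T v = sigmaMax T) ↔
      ∃ c : k → ℂ, star c ⬝ᵥ c = 1 ∧ u = WithLp.toLp 2 (Q *ᵥ c) ∧ v = WithLp.toLp 2 (P *ᵥ c) := by
  have hσ' : (sigmaMax T : ℂ) ≠ 0 := by exact_mod_cast hσ.ne'
  constructor
  · rintro ⟨hu, hv, huv⟩
    -- Equality in Cauchy–Schwarz for `T` and for `Tᴴ` gives `T v = σ u` and `Tᴴ u = σ v`, so `v` is
    -- a right singular vector and `complete` applies.
    have hTv : (WithLp.toLp 2 (T *ᵥ v.ofLp) : EuclideanSpace ℂ o) = (sigmaMax T : ℂ) • u :=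
      eq_smul_of_re_inner ((norm_mulVec_le T v).trans
        (mul_le_of_le_one_right (sigmaMax_nonneg T) hv)) hu (by rw [← rePair_eq_inner, huv])
    have hTu : (WithLp.toLp 2 (Tᴴ *ᵥ u.ofLp) : EuclideanSpace ℂ i) = (sigmaMax T : ℂ) • v :=
      eq_smul_of_re_inner ((norm_conjTranspose_mulVec_le T u).trans
        (mul_le_of_le_one_right (sigmaMax_nonneg T) hu)) hv
        (by rw [← rePair_eq_inner, rePair_conjTranspose, huv])
    have hTv' : T *ᵥ v.ofLp = (sigmaMax T : ℂ) • u.ofLp := congrArg WithLp.ofLp hTv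
    have hTu' : Tᴴ *ᵥ u.ofLp = (sigmaMax T : ℂ) • v.ofLp := congrArg WithLp.ofLp hTu
    obtain ⟨c, hc⟩ := h.complete v.ofLp (by
      rw [← Matrix.mulVec_mulVec, hTv', Matrix.mulVec_smul, hTu', smul_smul, sq])
    have hv1 : ‖v‖ = 1 := by
      refine le_antisymm hv ?_
      have h1 := rePair_le u T v
      rw [huv] at h1
      have h2 : 1 ≤ ‖u‖ * ‖v‖ := le_of_mul_le_mul_left (by simpa using h1) hσ
      exact h2.trans (mul_le_of_le_one_left (norm_nonneg v) hu)
    refine ⟨c, ?_, ?_, ?_⟩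
    · have h1 := norm_toLp_sq v.ofLp
      have h2 := star_mulVec_dotProduct_mulVec P 1 P c
      rw [Matrix.one_mulVec, Matrix.mul_one, h.right_orthonormal, Matrix.one_mulVec, ← hc] at h2
      rw [← h2, ← h1, WithLp.toLp_ofLp, hv1]
      simp
    · have h1 : (sigmaMax T : ℂ) • u.ofLp = (sigmaMax T : ℂ) • (Q *ᵥ c) := by
        rw [← hTv', hc, Matrix.mulVec_mulVec, h.map_right, Matrix.smul_mulVec]
      have h2 := smul_right_injective _ hσ' h1
      rw [← h2]
    · rw [← hc]
  · rintro ⟨c, hc, rfl, rfl⟩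
    refine ⟨(norm_mulVec_of_isometry h.left_orthonormal hc).le,
      (norm_mulVec_of_isometry h.right_orthonormal hc).le, ?_⟩
    have h1 := star_mulVec_dotProduct_mulVec Q T P c
    rw [Matrix.mul_assoc, h.map_right, Matrix.mul_smul, h.left_orthonormal, Matrix.smul_mulVec,
      Matrix.one_mulVec, dotProduct_smul, hc] at h1
    rw [rePair, h1]
    simp

end SingularVectors

/-! ### From rank-one weights to positive semidefinite weights of total trace one. -/

section Spectral

/-- Spectral decomposition of a positive semidefinite matrix, tested against trace functionals. -/
theorem exists_trace_mul_eq_sum {k : Type*} [Fintype k] [DecidableEq k] {Y : Matrix k k ℂ}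
    (hY : Y.PosSemidef) : ∃ (l : k → ℝ) (c : k → k → ℂ), (∀ j, 0 ≤ l j) ∧
      (∀ j, star (c j) ⬝ᵥ c j = 1) ∧ Y.trace = ((∑ j, l j : ℝ) : ℂ) ∧
      ∀ W : Matrix k k ℂ, (W * Y).trace = ∑ j, (l j : ℂ) * (star (c j) ⬝ᵥ (W *ᵥ c j)) := by
  set V : Matrix k k ℂ := (hY.1.eigenvectorUnitary : Matrix k k ℂ)
  have hentry : ∀ (W : Matrix k k ℂ) (j : k),
      star (V.col j) ⬝ᵥ (W *ᵥ V.col j) = (Vᴴ * W * V) j j := by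
    intro W j
    rw [Matrix.mul_assoc]
    rfl
  refine ⟨hY.1.eigenvalues, fun j => V.col j, hY.eigenvalues_nonneg, fun j => ?_, ?_, fun W => ?_⟩
  · have h1 := hentry 1 j
    have h2 : Vᴴ * V = 1 := Unitary.coe_star_mul_self hY.1.eigenvectorUnitary
    rwa [Matrix.one_mulVec, Matrix.mul_one, h2, Matrix.one_apply_eq] at h1
  · rw [hY.1.trace_eq_sum_eigenvalues]
    simp
  · have h1 : Y = V * Matrix.diagonal (fun j => (hY.1.eigenvalues j : ℂ)) * Vᴴ := by
      conv_lhs => rw [hY.1.spectral_theorem]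
      rfl
    conv_lhs => rw [h1]
    rw [← Matrix.mul_assoc, Matrix.trace_mul_comm, ← Matrix.mul_assoc, ← Matrix.mul_assoc,
      Matrix.trace]
    refine Finset.sum_congr rfl fun j _ => ?_
    rw [Matrix.diag_apply, Matrix.mul_diagonal, hentry, mul_comm]

/-- The vector with entries `-Re Trace (W_j Y)`, as a linear function of `Y`. -/
noncomputable def negTraceVec {m : ℕ} {k : Type*} [Fintype k] (W : Fin m → Matrix k k ℂ) :
    Matrix k k ℂ →ₗ[ℝ] EuclideanSpace ℝ (Fin m) where
  toFun Y := WithLp.toLp 2 fun j => -(W j * Y).trace.re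
  map_add' X Y := by
    ext j
    simp [Matrix.mul_add, add_comm]
  map_smul' a Y := by
    ext j
    simp

theorem trace_mul_vecMulVec {k : Type*} [Fintype k] (W : Matrix k k ℂ) (c : k → ℂ) :
    (W * Matrix.vecMulVec c (star c)).trace = star c ⬝ᵥ (W *ᵥ c) := by
  rw [Matrix.mul_vecMulVec, Matrix.trace_vecMulVec, dotProduct_comm]

/-- Convex hull of the vectors generated by rank-one trace-one weights. -/
theorem convexHull_negTraceVec {m : ℕ} {α : Type*} {k : α → ℕ} (Ω : Set α)
    (W : ∀ a, Fin m → Matrix (Fin (k a)) (Fin (k a)) ℂ) :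
    convexHull ℝ {g | ∃ a ∈ Ω, ∃ c : Fin (k a) → ℂ, star c ⬝ᵥ c = 1 ∧
        g = negTraceVec (W a) (Matrix.vecMulVec c (star c))} =
      {φ | ∃ (F : Finset α) (Y : ∀ a, Matrix (Fin (k a)) (Fin (k a)) ℂ), (F : Set α) ⊆ Ω ∧
        (∀ a ∈ F, (Y a).PosSemidef) ∧ ∑ a ∈ F, (Y a).trace = 1 ∧
        φ = ∑ a ∈ F, negTraceVec (W a) (Y a)} := by
  classical
  apply Set.Subset.antisymm
  · refine convexHull_min ?_ ?_
    · rintro _ ⟨a, ha, c, hc, rfl⟩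
      refine ⟨{a}, Function.update (fun _ => 0) a (Matrix.vecMulVec c (star c)), by simpa using ha,
        ?_, ?_, ?_⟩
      · intro b hb
        rw [Finset.mem_singleton] at hb
        subst hb
        rw [Function.update_self]
        exact Matrix.posSemidef_vecMulVec_self_star c
      · rw [Finset.sum_singleton, Function.update_self, Matrix.trace_vecMulVec, dotProduct_comm, hc]
      · rw [Finset.sum_singleton, Function.update_self]
    · rintro _ ⟨F₁, Y₁, hF₁, hY₁, ht₁, rfl⟩ _ ⟨F₂, Y₂, hF₂, hY₂, ht₂, rfl⟩ s t hs ht hst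
      -- Each `Yᵢ` is unconstrained off `Fᵢ`, so it is cut to zero there before averaging.
      refine ⟨F₁ ∪ F₂, fun a => s • (if a ∈ F₁ then Y₁ a else 0) + t • (if a ∈ F₂ then Y₂ a else 0),
        by simp [hF₁, hF₂], fun a _ => ?_, ?_, ?_⟩
      · refine .add (.smul ?_ hs) (.smul ?_ ht)
        · split_ifs with h
          exacts [hY₁ a h, .zero]
        · split_ifs with h
          exacts [hY₂ a h, .zero]
      · simp only [Matrix.trace_add, Matrix.trace_smul, Finset.sum_add_distrib, ← Finset.smul_sum,
          apply_ite Matrix.trace, Matrix.trace_zero, Finset.sum_ite_mem, Finset.union_inter_cancel_left,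
          Finset.union_inter_cancel_right, ht₁, ht₂]
        rw [← add_smul, hst, one_smul]
      · simp only [map_add, map_smul, apply_ite (negTraceVec (W _)), map_zero,
          Finset.sum_add_distrib, ← Finset.smul_sum, Finset.sum_ite_mem,
          Finset.union_inter_cancel_left, Finset.union_inter_cancel_right]
  · rintro _ ⟨F, Y, hF, hY, ht, rfl⟩
    have hex : ∀ a, ∃ (l : Fin (k a) → ℝ) (c : Fin (k a) → Fin (k a) → ℂ), a ∈ F →
        (∀ j, 0 ≤ l j) ∧ (∀ j, star (c j) ⬝ᵥ c j = 1) ∧ (Y a).trace = ((∑ j, l j : ℝ) : ℂ) ∧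
        ∀ V : Matrix (Fin (k a)) (Fin (k a)) ℂ,
          (V * Y a).trace = ∑ j, (l j : ℂ) * (star (c j) ⬝ᵥ (V *ᵥ c j)) := by
      intro a
      by_cases ha : a ∈ F
      · obtain ⟨l, c, h⟩ := exists_trace_mul_eq_sum (hY a ha)
        exact ⟨l, c, fun _ => h⟩
      · exact ⟨0, 0, fun h => absurd h ha⟩
    choose l c hlc using hex
    -- The convex weights are all the eigenvalues of all the `Y a`; they sum to the total trace.
    have hsum : ∑ a ∈ F, negTraceVec (W a) (Y a) = ∑ p ∈ F.sigma fun a => (Finset.univ : Finset (Fin (k a))),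
        l p.1 p.2 • negTraceVec (W p.1) (Matrix.vecMulVec (c p.1 p.2) (star (c p.1 p.2))) := by
      rw [Finset.sum_sigma]
      refine Finset.sum_congr rfl fun a ha => ?_
      ext j
      simp [negTraceVec, (hlc a ha).2.2.2, trace_mul_vecMulVec]
    rw [hsum]
    refine (convex_convexHull ℝ _).sum_mem ?_ ?_ ?_
    · rintro ⟨a, j⟩ hp
      exact (hlc a (Finset.mem_sigma.1 hp).1).1 j
    · rw [Finset.sum_sigma]
      have : ((∑ a ∈ F, ∑ j, l a j : ℝ) : ℂ) = 1 := by
        rw [← ht, Complex.ofReal_sum]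
        exact Finset.sum_congr rfl fun a ha => (hlc a ha).2.2.1.symm
      exact_mod_cast this
    · rintro ⟨a, j⟩ hp
      have ha := (Finset.mem_sigma.1 hp).1
      exact subset_convexHull ℝ _ ⟨a, hF ha, c a j, (hlc a ha).2.1 j, rfl⟩

end Spectral

end Robust

namespace Robust

open Filter Topology

/-! ### The `H_∞` norm as a compact maximum, and its active gradients. -/

section HinfFamily

variable {m nx nK m₁ p₁ m₂ p₂ : ℕ} {r : Fin m → ℕ}

/-- A frequency together with a pair of vectors of the unit balls. -/
abbrev FreqBall (p₁ m₁ : ℕ) : Type :=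
  ℝ≥0∞ × Metric.closedBall (0 : EuclideanSpace ℂ (Fin p₁)) 1 ×
    Metric.closedBall (0 : EuclideanSpace ℂ (Fin m₁)) 1

/-- Balls rather than spheres keep the index space non-empty even when `p₁` or `m₁` is zero. -/
instance {p₁ m₁ : ℕ} : Nonempty (FreqBall p₁ m₁) :=
  ⟨(0, ⟨0, by simp⟩, ⟨0, by simp⟩)⟩

instance {p₁ m₁ : ℕ} : CompactSpace (FreqBall p₁ m₁) :=
  have : CompactSpace (Metric.closedBall (0 : EuclideanSpace ℂ (Fin p₁)) 1) :=
    isCompact_iff_compactSpace.1 (isCompact_closedBall _ _)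
  have : CompactSpace (Metric.closedBall (0 : EuclideanSpace ℂ (Fin m₁)) 1) :=
    isCompact_iff_compactSpace.1 (isCompact_closedBall _ _)
  inferInstance

/-- The sensitivity `T_zp(δ', jω) Δ_j T_qw(δ, jω)`. -/
noncomputable def sensitivity (P : Plant r nx m₁ p₁ m₂ p₂) (K : Controller nK m₂ p₂)
    (δ' δ : EuclideanSpace ℝ (Fin m)) (ω : ℝ≥0∞) (j : Fin m) : Matrix (Fin p₁) (Fin m₁) ℂ :=
  Tzp P K δ' ω * toC (uncertaintyPartial r j) * Tqw P K δ ω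

theorem continuous_rePair : Continuous fun q : EuclideanSpace ℂ (Fin p₁) ×
    Matrix (Fin p₁) (Fin m₁) ℂ × EuclideanSpace ℂ (Fin m₁) => rePair q.1 q.2.1 q.2.2 := by
  have h1 : Continuous fun q : EuclideanSpace ℂ (Fin p₁) × Matrix (Fin p₁) (Fin m₁) ℂ ×
      EuclideanSpace ℂ (Fin m₁) => star q.1.ofLp :=
    ((PiLp.continuous_ofLp 2 _).comp continuous_fst).star
  have h2 : Continuous fun q : EuclideanSpace ℂ (Fin p₁) × Matrix (Fin p₁) (Fin m₁) ℂ ×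
      EuclideanSpace ℂ (Fin m₁) => q.2.2.ofLp :=
    (PiLp.continuous_ofLp 2 _).comp (continuous_snd.comp continuous_snd)
  have h3 : Continuous fun q : EuclideanSpace ℂ (Fin p₁) × Matrix (Fin p₁) (Fin m₁) ℂ ×
      EuclideanSpace ℂ (Fin m₁) => q.2.1 := continuous_fst.comp continuous_snd
  exact Complex.continuous_re.comp (h1.dotProduct (h3.matrix_mulVec h2))

theorem _root_.ContinuousAt.rePair {X : Type*} [TopologicalSpace X]
    {u : X → EuclideanSpace ℂ (Fin p₁)} {T : X → Matrix (Fin p₁) (Fin m₁) ℂ}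
    {v : X → EuclideanSpace ℂ (Fin m₁)} {x : X} (hu : ContinuousAt u x) (hT : ContinuousAt T x)
    (hv : ContinuousAt v x) : ContinuousAt (fun y => Robust.rePair (u y) (T y) (v y)) x := by
  have h := continuous_rePair.continuousAt.comp (hu.prodMk (hT.prodMk hv))
  exact h

theorem continuousAt_rePair_Tzw {P : Plant r nx m₁ p₁ m₂ p₂} {K : Controller nK m₂ p₂}
    {δ : EuclideanSpace ℝ (Fin m)} (hδ : δ ∈ stableSet P K) (s : FreqBall p₁ m₁) :
    ContinuousAt (fun p : EuclideanSpace ℝ (Fin m) × FreqBall p₁ m₁ =>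
      rePair p.2.2.1.1 (Tzw P K p.1 p.2.1) p.2.2.2.1) (δ, s) := by
  refine ContinuousAt.rePair (Continuous.continuousAt (by fun_prop)) ?_
    (Continuous.continuousAt (by fun_prop))
  exact ContinuousAt.comp (f := fun p : EuclideanSpace ℝ (Fin m) × FreqBall p₁ m₁ => (p.1, p.2.1))
    (g := fun p : EuclideanSpace ℝ (Fin m) × ℝ≥0∞ => Tzw P K p.1 p.2)
    (continuousAt_Tzw hδ s.1) (Continuous.continuousAt (by fun_prop))

theorem continuousAt_rePair_sensitivity {P : Plant r nx m₁ p₁ m₂ p₂} {K : Controller nK m₂ p₂}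
    {δ : EuclideanSpace ℝ (Fin m)} (hδ : δ ∈ stableSet P K) (j : Fin m) (s : FreqBall p₁ m₁) :
    ContinuousAt (fun p : (EuclideanSpace ℝ (Fin m) × EuclideanSpace ℝ (Fin m)) × FreqBall p₁ m₁ =>
      rePair p.2.2.1.1 (sensitivity P K p.1.1 p.1.2 p.2.1 j) p.2.2.2.1) ((δ, δ), s) := by
  refine ContinuousAt.rePair (Continuous.continuousAt (by fun_prop)) ?_
    (Continuous.continuousAt (by fun_prop))
  refine ContinuousAt.matrix_mul (ContinuousAt.matrix_mul ?_ continuousAt_const) ?_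
  · exact ContinuousAt.comp (f := fun p : (EuclideanSpace ℝ (Fin m) × EuclideanSpace ℝ (Fin m)) ×
        FreqBall p₁ m₁ => (p.1.1, p.2.1))
      (g := fun p : EuclideanSpace ℝ (Fin m) × ℝ≥0∞ => Tzp P K p.1 p.2)
      (continuousAt_Tzp hδ s.1) (Continuous.continuousAt (by fun_prop))
  · exact ContinuousAt.comp (f := fun p : (EuclideanSpace ℝ (Fin m) × EuclideanSpace ℝ (Fin m)) ×
        FreqBall p₁ m₁ => (p.1.2, p.2.1))
      (g := fun p : EuclideanSpace ℝ (Fin m) × ℝ≥0∞ => Tqw P K p.1 p.2)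
      (continuousAt_Tqw hδ s.1) (Continuous.continuousAt (by fun_prop))

theorem bddAbove_sigmaMax {P : Plant r nx m₁ p₁ m₂ p₂} {K : Controller nK m₂ p₂}
    {δ : EuclideanSpace ℝ (Fin m)} (hδ : δ ∈ stableSet P K) :
    BddAbove (Set.range fun ω : ℝ≥0∞ => sigmaMax (Tzw P K δ ω)) := by
  have hc : Continuous fun s : FreqBall p₁ m₁ => rePair s.2.1.1 (Tzw P K δ s.1) s.2.2.1 :=
    continuous_iff_continuousAt.2 fun s => ContinuousAt.comp
      (f := fun s : FreqBall p₁ m₁ => (δ, s)) (continuousAt_rePair_Tzw hδ s)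
      (Continuous.continuousAt (by fun_prop))
  obtain ⟨C, hC⟩ := (isCompact_range hc).bddAbove
  refine ⟨C, ?_⟩
  rintro _ ⟨ω, rfl⟩
  exact sigmaMax_le fun u v hu hv => hC ⟨(ω, ⟨u, by simpa using hu⟩, ⟨v, by simpa using hv⟩), rfl⟩

theorem sigmaMax_le_hinfNorm {P : Plant r nx m₁ p₁ m₂ p₂} {K : Controller nK m₂ p₂}
    {δ : EuclideanSpace ℝ (Fin m)} (hδ : δ ∈ stableSet P K) (ω : ℝ≥0∞) :
    sigmaMax (Tzw P K δ ω) ≤ hinfNorm (Tzw P K δ) :=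
  le_ciSup (bddAbove_sigmaMax hδ) ω

theorem rePair_finset_sum {ι : Type*} (F : Finset ι) (a : ι → ℝ)
    (N : ι → Matrix (Fin p₁) (Fin m₁) ℂ) (u : EuclideanSpace ℂ (Fin p₁))
    (v : EuclideanSpace ℂ (Fin m₁)) :
    rePair u (∑ j ∈ F, (a j : ℂ) • N j) v = ∑ j ∈ F, a j * rePair u (N j) v := by
  simp only [rePair, Matrix.sum_mulVec, dotProduct_sum, Complex.re_sum, Matrix.smul_mulVec,
    dotProduct_smul, smul_eq_mul, Complex.re_ofReal_mul]

/-- On the stable set the `H_∞` norm is the maximum of a compact family of smooth functions. -/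
theorem isMaxFamily_hinfNorm (P : Plant r nx m₁ p₁ m₂ p₂) (K : Controller nK m₂ p₂) :
    IsMaxFamily (stableSet P K) (fun δ => hinfNorm (Tzw P K δ))
      (fun δ (s : FreqBall p₁ m₁) => rePair s.2.1.1 (Tzw P K δ s.1) s.2.2.1)
      (fun δ' δ s => WithLp.toLp 2 fun j =>
        rePair s.2.1.1 (sensitivity P K δ' δ s.1 j) s.2.2.1) where
  isOpen := isOpen_stableSet P K
  isLUB δ hδ := by
    constructor
    · rintro _ ⟨⟨ω, u, v⟩, rfl⟩
      exact (rePair_le_sigmaMax _ (mem_closedBall_zero_iff.1 u.2)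
        (mem_closedBall_zero_iff.1 v.2)).trans
        (sigmaMax_le_hinfNorm hδ ω)
    · intro b hb
      exact ciSup_le fun ω => sigmaMax_le fun u v hu hv =>
        hb ⟨(ω, ⟨u, by simpa using hu⟩, ⟨v, by simpa using hv⟩), rfl⟩
  slope δ hδ δ' hδ' s := by
    have h1 : rePair s.2.1.1 (Tzw P K δ' s.1) s.2.2.1 - rePair s.2.1.1 (Tzw P K δ s.1) s.2.2.1 =
        rePair s.2.1.1 (Tzw P K δ' s.1 - Tzw P K δ s.1) s.2.2.1 := by
      simp only [rePair, Matrix.sub_mulVec, dotProduct_sub, Complex.sub_re]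
    rw [h1, Tzw_sub hδ hδ', rePair_finset_sum, PiLp.inner_apply]
    rfl
  continuousAt δ hδ s := continuousAt_rePair_Tzw hδ s
  continuousAt_slope δ hδ s := by
    have h : ContinuousAt (fun (p : (EuclideanSpace ℝ (Fin m) × EuclideanSpace ℝ (Fin m)) ×
        FreqBall p₁ m₁) (j : Fin m) =>
          rePair p.2.2.1.1 (sensitivity P K p.1.1 p.1.2 p.2.1 j) p.2.2.2.1) ((δ, δ), s) :=
      continuousAt_pi.2 fun j => continuousAt_rePair_sensitivity hδ j s
    exact ContinuousAt.comp (g := WithLp.toLp 2) (PiLp.continuous_toLp 2 _).continuousAt h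

/-- As `Δ_j` is real, the transposes and the real part pass through the trace, and cyclicity moves
`Q_ωᴴ T_zp` to the front. -/
theorem phiVec_PhiY (P : Plant r nx m₁ p₁ m₂ p₂) (K : Controller nK m₂ p₂)
    (δ : EuclideanSpace ℝ (Fin m)) {k : ℝ≥0∞ → ℕ}
    (Pω : ∀ ω : ℝ≥0∞, Matrix (Fin m₁) (Fin (k ω)) ℂ)
    (Qω : ∀ ω : ℝ≥0∞, Matrix (Fin p₁) (Fin (k ω)) ℂ)
    (F : Finset ℝ≥0∞) (Y : ∀ ω : ℝ≥0∞, Matrix (Fin (k ω)) (Fin (k ω)) ℂ) :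
    phiVec (PhiY P K δ Pω Qω F Y) =
      ∑ ω ∈ F, negTraceVec (fun j => (Qω ω)ᴴ * sensitivity P K δ δ ω j * Pω ω) (Y ω) := by
  ext j
  have key : ∀ X : Matrix (Chan r) (Chan r) ℂ,
      ((uncertaintyPartial r j)ᵀ * (X.map Complex.re)ᵀ).trace =
        (toC (uncertaintyPartial r j) * X).trace.re := by
    intro X
    rw [← Matrix.transpose_mul, Matrix.trace_transpose, Matrix.trace_mul_comm]
    simp only [uncertaintyPartial, Matrix.trace, Matrix.diag_apply, Matrix.mul_apply,
      Complex.re_sum, Matrix.map_apply, Complex.re_ofReal_mul]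
  simp only [phiVec, PhiY, Matrix.mul_neg, Matrix.trace_neg, Matrix.mul_sum, Matrix.trace_sum, key,
    WithLp.ofLp_sum, Finset.sum_apply, ← Finset.sum_neg_distrib]
  refine Finset.sum_congr rfl fun ω _ => ?_
  simp only [negTraceVec, LinearMap.coe_mk, AddHom.coe_mk]
  congr 2
  rw [sensitivity]
  have : ((Qω ω)ᴴ * (Tzp P K δ ω * toC (uncertaintyPartial r j) * Tqw P K δ ω) * Pω ω * Y ω) =
      ((Qω ω)ᴴ * Tzp P K δ ω) * (toC (uncertaintyPartial r j) * (Tqw P K δ ω * Pω ω * Y ω)) := by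
    simp only [Matrix.mul_assoc]
  rw [this, Matrix.trace_mul_comm ((Qω ω)ᴴ * Tzp P K δ ω)]
  simp only [Matrix.mul_assoc]

/-- Positivity of the norm is essential: for a zero transfer function every pair `(u, v)` would be
active, not only singular pairs. -/
theorem negActiveGrad_hinfNorm {P : Plant r nx m₁ p₁ m₂ p₂} {K : Controller nK m₂ p₂}
    {δ : EuclideanSpace ℝ (Fin m)} (hδ : δ ∈ stableSet P K) (h0 : hMinus P K δ ≠ 0)
    {k : ℝ≥0∞ → ℕ} {Pω : ∀ ω : ℝ≥0∞, Matrix (Fin m₁) (Fin (k ω)) ℂ}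
    {Qω : ∀ ω : ℝ≥0∞, Matrix (Fin p₁) (Fin (k ω)) ℂ}
    (hPQ : ∀ ω ∈ activeFreq (Tzw P K δ), IsMaxSingularPair (Tzw P K δ ω) (Pω ω) (Qω ω)) :
    IsMaxFamily.negActiveGrad (fun δ => hinfNorm (Tzw P K δ))
      (fun δ (s : FreqBall p₁ m₁) => rePair s.2.1.1 (Tzw P K δ s.1) s.2.2.1)
      (fun δ' δ s => WithLp.toLp 2 fun j =>
        rePair s.2.1.1 (sensitivity P K δ' δ s.1 j) s.2.2.1) δ =
    {g | ∃ ω ∈ activeFreq (Tzw P K δ), ∃ c : Fin (k ω) → ℂ, star c ⬝ᵥ c = 1 ∧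
      g = negTraceVec (fun j => (Qω ω)ᴴ * sensitivity P K δ δ ω j * Pω ω)
        (Matrix.vecMulVec c (star c))} := by
  have hpos : 0 < hinfNorm (Tzw P K δ) :=
    lt_of_le_of_ne ((sigmaMax_nonneg _).trans (sigmaMax_le_hinfNorm hδ 0))
      fun h => h0 (by rw [hMinus, ← h, neg_zero])
  have hgrad : ∀ (ω : ℝ≥0∞) (c : Fin (k ω) → ℂ),
      -(WithLp.toLp 2 fun j => rePair (WithLp.toLp 2 (Qω ω *ᵥ c)) (sensitivity P K δ δ ω j)
        (WithLp.toLp 2 (Pω ω *ᵥ c)) : EuclideanSpace ℝ (Fin m)) =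
      negTraceVec (fun j => (Qω ω)ᴴ * sensitivity P K δ δ ω j * Pω ω)
        (Matrix.vecMulVec c (star c)) := by
    intro ω c
    ext j
    change -(star (Qω ω *ᵥ c) ⬝ᵥ (sensitivity P K δ δ ω j *ᵥ (Pω ω *ᵥ c))).re = _
    rw [star_mulVec_dotProduct_mulVec, ← trace_mul_vecMulVec]
    rfl
  ext g
  constructor
  · rintro ⟨⟨ω, ⟨u, hu⟩, ⟨v, hv⟩⟩, hs, rfl⟩
    simp only [Set.mem_ofPred_eq] at hs
    rw [mem_closedBall_zero_iff] at hu hv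
    -- The chain pairing `≤ σ_max ≤` norm has equal ends, so `ω` is active and `(u, v)` is maximal
    -- at `ω`.
    have hω : ω ∈ activeFreq (Tzw P K δ) :=
      le_antisymm (sigmaMax_le_hinfNorm hδ ω) (hs ▸ rePair_le_sigmaMax _ hu hv)
    have hω' : sigmaMax (Tzw P K δ ω) = hinfNorm (Tzw P K δ) := hω
    obtain ⟨c, hc, rfl, rfl⟩ := (rePair_eq_sigmaMax_iff (hPQ ω hω) (hω' ▸ hpos) u v).1
      ⟨hu, hv, hs.trans hω'.symm⟩
    exact ⟨ω, hω, c, hc, hgrad ω c⟩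
  · rintro ⟨ω, hω, c, hc, rfl⟩
    have hω' : sigmaMax (Tzw P K δ ω) = hinfNorm (Tzw P K δ) := hω
    obtain ⟨hu, hv, huv⟩ := (rePair_eq_sigmaMax_iff (hPQ ω hω) (hω' ▸ hpos) _ _).2
      ⟨c, hc, rfl, rfl⟩
    exact ⟨(ω, ⟨_, mem_closedBall_zero_iff.2 hu⟩, ⟨_, mem_closedBall_zero_iff.2 hv⟩),
      huv.trans hω', hgrad ω c⟩

end HinfFamily

end Robust

theorem proposition1 {m nx nK m₁ p₁ m₂ p₂ : ℕ} {r : Fin m → ℕ}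
    (P : Robust.Plant r nx m₁ p₁ m₂ p₂) (K : Robust.Controller nK m₂ p₂)
    (hPK : P.LowerWellPosed K) :
    IsOpen (Robust.stableSet P K) ∧
    ∀ δ ∈ Robust.stableSet P K,
      BddAbove (Set.range fun ω : ℝ≥0∞ => Robust.sigmaMax (Robust.Tzw P K δ ω)) ∧
      Robust.LipschitzNear (Robust.hMinus P K) δ ∧
      (Robust.clarkeSubdiff (Robust.hMinus P K) δ).Nonempty ∧
      IsCompact (Robust.clarkeSubdiff (Robust.hMinus P K) δ) ∧
      Convex ℝ (Robust.clarkeSubdiff (Robust.hMinus P K) δ) ∧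
      (Robust.hMinus P K δ ≠ 0 →
        ∀ (k : ℝ≥0∞ → ℕ)
          (Pω : ∀ ω : ℝ≥0∞, Matrix (Fin m₁) (Fin (k ω)) ℂ)
          (Qω : ∀ ω : ℝ≥0∞, Matrix (Fin p₁) (Fin (k ω)) ℂ),
          (∀ ω ∈ Robust.activeFreq (Robust.Tzw P K δ),
            Robust.IsMaxSingularPair (Robust.Tzw P K δ ω) (Pω ω) (Qω ω)) →
          Robust.clarkeSubdiff (Robust.hMinus P K) δ =
            {φ | ∃ (F : Finset ℝ≥0∞)
                (Y : ∀ ω : ℝ≥0∞, Matrix (Fin (k ω)) (Fin (k ω)) ℂ),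
              (F : Set ℝ≥0∞) ⊆ Robust.activeFreq (Robust.Tzw P K δ) ∧
              (∀ ω ∈ F, (Y ω).PosSemidef) ∧
              ∑ ω ∈ F, (Y ω).trace = 1 ∧
              φ = Robust.phiVec (Robust.PhiY P K δ Pω Qω F Y)}) := by
  refine ⟨Robust.isOpen_stableSet P K, fun δ hδ => ?_⟩
  have hfam := Robust.isMaxFamily_hinfNorm P K
  have hsub := hfam.clarkeSubdiff_neg hδ
  change Robust.clarkeSubdiff (Robust.hMinus P K) δ = _ at hsub
  refine ⟨Robust.bddAbove_sigmaMax hδ, ?_, ?_, ?_, Robust.convex_clarkeSubdiff _ _, ?_⟩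
  · obtain ⟨L, V, hV, hL⟩ := hfam.lipschitzNear hδ
    exact ⟨L, V, hV, hL.neg⟩
  · obtain ⟨s, hs⟩ := hfam.exists_eq hδ
    rw [hsub, convexHull_nonempty_iff]
    exact ⟨_, s, hs, rfl⟩
  · rw [hsub]
    exact Robust.isCompact_convexHull_of_isCompact (hfam.isCompact_negActiveGrad hδ)
  · intro h0 k Pω Qω hPQ
    rw [hsub, Robust.negActiveGrad_hinfNorm hδ h0 hPQ, Robust.convexHull_negTraceVec]
    simp only [Robust.phiVec_PhiY]
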